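/- Let $k\ge 1$. Consider the infinite directed graph on the vertices $0,1,2,\dots$ obtained by chaining $k$-elongated partition diamonds: for each $j\ge 0$, with $s=(2k+1)j$, the $j$-th diamond consists of the vertex $s$, the $k$ pairs $\{s+2i+1,\,s+2i+2\}$ for $0\le i<k$, and the vertex $s+2k+1$ (which is the first vertex of the next diamond), with an edge from each vertex of a layer to each vertex of the next layer. A broken $k$-diamond partition of $n$ is a pair $(a,b)$, where $a=(a_v)_{v\ge 0}$ and $b=(b_v)_{v\ge 1}$ are finitely supported families of nonnegative integers such that $a_u\ge a_v$ for every edge $u\to v$, $b_u\ge b_v$ for every edge $u\to v$ with $u,v\ge 1$ (the source $0$ is deleted), and $\sum_{v\ge 0} a_v+\sum_{v\ge 1} b_v=n$. Let $\Delta_k(n)$ be the number of broken $k$-diamond partitions of $n$. Theorem. If $k\equiv 62\pmod{125}$, then for all $n\ge 0$, $$\Delta_k(125n+99)\equiv 0\pmod{25}.$$ -/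

import Mathlib

/-- The directed graph formed by an infinite chain of `k`-elongated partition diamonds
(`k ≥ 1`), with vertices `0, 1, 2, …`.  The `j`-th diamond occupies the vertices from
`s = (2k+1)j` to `s + 2k + 1 = (2k+1)(j+1)`, and its last vertex is the first vertex of the
next diamond.  It consists of the vertex `s`, then `k` pairs `{s+2i+1, s+2i+2}`
(`0 ≤ i < k`), then the vertex `s+2k+1`; edges go from every vertex of a layer to every
vertex of the next layer.  The vertex `0` is the source of the chain. -/
inductive DiamondEdge (k : ℕ) : ℕ → ℕ → Prop
  /-- From the first vertex of a diamond to its first pair. -/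
  | first (j e : ℕ) (hk : 0 < k) (he : e < 2) :
      DiamondEdge k ((2 * k + 1) * j) ((2 * k + 1) * j + 1 + e)
  /-- From the `i`-th pair of a diamond to its next pair. -/
  | cross (j i e f : ℕ) (hi : i + 1 < k) (he : e < 2) (hf : f < 2) :
      DiamondEdge k ((2 * k + 1) * j + (2 * i + 1) + e) ((2 * k + 1) * j + (2 * i + 3) + f)
  /-- From the last pair of a diamond (`i = k - 1`) to its last vertex. -/
  | last (j i e : ℕ) (hi : i + 1 = k) (he : e < 2) :
      DiamondEdge k ((2 * k + 1) * j + (2 * i + 1) + e) ((2 * k + 1) * (j + 1))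

/-- The broken `k`-diamond partitions of `n`: pairs `(a, b)` of finitely supported labellings
by natural numbers, `a` of a chain of `k`-elongated diamonds, and `b` of a second such chain
whose source (the vertex `0`) is deleted, both weakly decreasing along the edges, such that
all labels together sum to `n`.  Here `b v` is the label of the vertex `v + 1`. -/
def brokenDiamondPartitions (k n : ℕ) : Set ((ℕ →₀ ℕ) × (ℕ →₀ ℕ)) :=
  {p | (∀ u v, DiamondEdge k u v → p.1 v ≤ p.1 u) ∧
       (∀ u v, DiamondEdge k (u + 1) (v + 1) → p.2 v ≤ p.2 u) ∧
       (p.1.sum fun _ x => x) + (p.2.sum fun _ x => x) = n}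

/-- `Δ_k(n)`, the number of broken `k`-diamond partitions of `n`. -/
noncomputable def brokenDiamondCount (k n : ℕ) : ℕ :=
  (brokenDiamondPartitions k n).ncard

theorem DiamondEdge.step {k : ℕ} (hk : 0 < k) (v : ℕ) :
    DiamondEdge k v (v + 2) ∨ (DiamondEdge k v (v + 1) ∧ DiamondEdge k (v + 1) (v + 2)) := by
  obtain ⟨j, r, hr, rfl⟩ : ∃ j r, r < 2 * k + 1 ∧ v = (2 * k + 1) * j + r :=
    ⟨v / (2 * k + 1), v % (2 * k + 1), Nat.mod_lt _ (by omega), (Nat.div_add_mod _ _).symm⟩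
  rcases Nat.eq_zero_or_pos r with rfl | hr0
  · exact Or.inl (DiamondEdge.first j 1 hk (by norm_num))
  obtain ⟨i, e, he, rfl⟩ : ∃ i e, e < 2 ∧ r = 2 * i + 1 + e :=
    ⟨(r - 1) / 2, (r - 1) % 2, by omega, by omega⟩
  rcases Nat.lt_or_ge (i + 1) k with hi | hi
  · left
    have h := DiamondEdge.cross j i e e hi he he
    convert h using 1 <;> ring
  · have hi' : i + 1 = k := by omega
    have h := DiamondEdge.last j i e hi' he
    have h2 := DiamondEdge.first (k := k) (j + 1) 0 hk (by norm_num)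
    subst hi'
    interval_cases e
    · left
      convert h using 1 <;> ring
    · right
      constructor
      · convert h using 1 <;> ring
      · convert h2 using 1 <;> ring

theorem Finsupp.lt_of_step {f : ℕ →₀ ℕ} (hf : ∀ v, f (v + 2) ≤ f v) {n : ℕ}
    (hn : (f.sum fun _ x => x) ≤ n) {v : ℕ} (hv : f v ≠ 0) : v < 2 * n := by
  have key : ∀ i, 2 * i ≤ v → f (v - 2 * i) ≠ 0 := by
    intro i
    induction i with
    | zero => intro _; simpa using hv
    | succ i ih =>
      intro h
      have h1 := ih (by omega)
      have h2 := hf (v - 2 * (i + 1))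
      rw [show v - 2 * (i + 1) + 2 = v - 2 * i by omega] at h2
      omega
  have hsub : (Finset.range (v / 2 + 1)).image (fun i => v - 2 * i) ⊆ f.support := by
    intro x hx
    obtain ⟨i, hi, rfl⟩ := Finset.mem_image.1 hx
    exact Finsupp.mem_support_iff.2 (key i (by have := Finset.mem_range.1 hi; omega))
  have hcard := Finset.card_le_card hsub
  rw [Finset.card_image_of_injOn, Finset.card_range] at hcard
  · have : f.support.card ≤ f.sum fun _ x => x := by
      rw [Finsupp.sum, Finset.card_eq_sum_ones]
      exact Finset.sum_le_sum fun x hx => Nat.one_le_iff_ne_zero.2 (Finsupp.mem_support_iff.1 hx)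
    omega
  · intro x hx y hy h
    simp only [Finset.coe_range, Set.mem_Iio] at hx hy
    simp only at h
    omega

theorem Finsupp.mem_box_of_step {f : ℕ →₀ ℕ} (hf : ∀ v, f (v + 2) ≤ f v) {n : ℕ}
    (hn : (f.sum fun _ x => x) ≤ n) :
    f ∈ (Finset.range (2 * n)).finsupp fun _ => Finset.range (n + 1) := by
  rw [Finset.mem_finsupp_iff]
  constructor
  · intro v hv
    exact Finset.mem_range.2 (Finsupp.lt_of_step hf hn (Finsupp.mem_support_iff.1 hv))
  · intro v _
    rw [Finset.mem_range]
    by_cases hv : f v = 0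
    · omega
    · have : f v ≤ f.sum fun _ x => x :=
        Finset.single_le_sum (f := fun i => f i) (fun _ _ => Nat.zero_le _)
          (Finsupp.mem_support_iff.2 hv)
      omega

/-- For `k ≥ 1` there are only finitely many broken `k`-diamond partitions of `n`, so that
`brokenDiamondCount` really counts them. -/
theorem brokenDiamondPartitions_finite {k : ℕ} (hk : 0 < k) (n : ℕ) :
    (brokenDiamondPartitions k n).Finite := by
  apply Set.Finite.subset
    (((Finset.range (2 * n)).finsupp fun _ => Finset.range (n + 1)) ×ˢ
      ((Finset.range (2 * n)).finsupp fun _ => Finset.range (n + 1))).finite_toSet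
  rintro ⟨a, b⟩ ⟨ha, hb, hs⟩
  change (a.sum fun _ x => x) + (b.sum fun _ x => x) = n at hs
  have h1 : (a.sum fun _ x => x) ≤ n := by omega
  have h2 : (b.sum fun _ x => x) ≤ n := by omega
  rw [Finset.mem_coe, Finset.mem_product]
  refine ⟨Finsupp.mem_box_of_step (fun v => ?_) h1,
    Finsupp.mem_box_of_step (fun v => ?_) h2⟩
  · rcases DiamondEdge.step hk v with h | ⟨h, h'⟩
    · exact ha _ _ h
    · exact (ha _ _ h').trans (ha _ _ h)
  · rcases DiamondEdge.step hk (v + 1) with h | ⟨h, h'⟩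
    · exact hb _ _ h
    · exact (hb _ _ h').trans (hb _ _ h)

/-! Write F_m for the product of 1 - q^(mn) over n ≥ 1. The generating function of Δ_k is F_2
F_(2k+1) / (F_1^3 F_(2(2k+1))) (`mk_brokenDiamondCount_mul`). The hypothesis on k makes 2k+1 a
multiple of 125, so two of the factors are series in q^125 and do not mix residue classes of
exponents modulo 125. It remains to see that the coefficients of B = F_2 / F_1^3 at 125n + 99 are
divisible by 25 (`dvd_coeff_brokenDiamondSeries`).

Generating function: if a chain has the pairs {u, u+1} with q(u) as its two-element layers, a
labelling is a decreasing sequence, that is, the conjugate of a partition, in which the labels of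
any pair with distinct entries may be exchanged. Distinct entries at i-1 and i mean that i is a
part, so each distinct part i with q(i-1) counts twice (`ncard_layerPartitions`).

Congruence: let s = q ψ(q^5)^2 / ψ(q)^2 with ψ = F_2^2 / F_1, and let U keep the coefficients at
multiples of 5. Level 10 theta identities give q B(q) (1 - 5s(q)) = (1 - s(q^5)) B(q^25) s(q)
(`X_mul_brokenDiamondSeries`). Since 1/(1 - 5s) = 1 + 5s modulo 25, applying U to q B P reduces to
applying U to (s + 5s^2) P. So one needs U(s) and U(s^2) modulo 25 and U(s^3) modulo 5
(`atkinFive_hauptmodul_pow_congr`). They give U U(q B) = 10 B (s - s^2) modulo 25, and one more step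
gives zero because U(s^2) = U(s^3) modulo 5.

The values U(s^k) come from a quintic for ρ = q^3 ψ(q^25) / ψ(q), whose square is s(q) s(q^5), with
coefficients that are polynomials in s(q^5) (`psiRatio_pow_five`). The quintic follows from the
5-dissection of ψ, from the product of ψ(ζq) over the fifth roots of unity ζ (`psi_norm`), and from
a formula for ψ(q)^2 - q ψ(q^5)^2 (`psi_sq`). The theta identities rest on the Jacobi triple
product, proved here as a limit of the q-binomial theorem. -/

open PowerSeries
open scoped PowerSeries.WithPiTopology

set_option linter.unusedSectionVars false

/-! ### Euler products as formal power series -/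

section EulerProducts

variable {R S : Type*} [CommRing R] [TopologicalSpace R] [CommRing S] [TopologicalSpace S]

theorem PowerSeries.continuous_of_coeff {A : Type*} [TopologicalSpace A] {f : A → R⟦X⟧}
    (h : ∀ d, Continuous fun a => coeff d (f a)) : Continuous f := by
  rw [continuous_iff_continuousAt]
  intro x
  rw [ContinuousAt, WithPiTopology.tendsto_iff_coeff_tendsto]
  exact fun d => (h d).tendsto x

theorem PowerSeries.continuous_expand {p : ℕ} (hp : p ≠ 0) :
    Continuous (expand p hp : R⟦X⟧ → R⟦X⟧) := by
  refine continuous_of_coeff fun d => ?_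
  simp_rw [coeff_expand]
  split_ifs
  · exact WithPiTopology.continuous_coeff R _
  · exact continuous_const

theorem PowerSeries.continuous_rescale [ContinuousMul R] (a : R) :
    Continuous (rescale a : R⟦X⟧ → R⟦X⟧) := by
  refine continuous_of_coeff fun d => ?_
  simp_rw [coeff_rescale]
  exact continuous_const.mul (WithPiTopology.continuous_coeff R _)

theorem PowerSeries.continuous_map {φ : R →+* S} (hφ : Continuous φ) :
    Continuous (map φ : R⟦X⟧ → S⟦X⟧) := by
  refine continuous_of_coeff fun d => ?_
  simp_rw [coeff_map]
  exact hφ.comp (WithPiTopology.continuous_coeff R _)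

theorem PowerSeries.multipliable_of_X_pow_dvd {F : ℕ → R⟦X⟧} (h : ∀ n, X ^ n ∣ F n - 1) :
    Multipliable F := by
  have : F = fun n => 1 + (F n - 1) := by ext1 n; ring
  rw [this]
  apply WithPiTopology.multipliable_one_add_of_tendsto_order_atTop_nhds_top
  refine ENat.tendsto_nhds_top_iff_natCast_lt.mpr fun n => Filter.eventually_atTop.mpr ⟨n + 1, ?_⟩
  intro m hm
  exact lt_of_lt_of_le (Nat.cast_lt.2 (Nat.lt_of_succ_le hm))
    (nat_le_order _ _ (X_pow_dvd_iff.1 (h m)))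

theorem PowerSeries.dvd_pow_sub_one {a b : R⟦X⟧} (h : a ∣ b - 1) (e : ℕ) : a ∣ b ^ e - 1 := by
  simpa using h.trans (sub_dvd_pow_sub_pow b 1 e)

theorem PowerSeries.multipliable_one_sub_X_pow_pow {g : ℕ → ℕ} (hg : ∀ n, n ≤ g n) (e : ℕ → ℕ) :
    Multipliable fun n => (1 - X ^ g n : R⟦X⟧) ^ e n := by
  refine multipliable_of_X_pow_dvd fun n => dvd_pow_sub_one ?_ _
  rw [sub_sub_cancel_left, dvd_neg]
  exact pow_dvd_pow _ (hg n)

theorem PowerSeries.multipliable_one_add_C_mul_X_pow {g : ℕ → ℕ} (hg : ∀ n, n ≤ g n) (c : R) :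
    Multipliable fun n => (1 + C c * X ^ g n : R⟦X⟧) := by
  refine multipliable_of_X_pow_dvd fun n => ?_
  rw [add_sub_cancel_left]
  exact (pow_dvd_pow _ (hg n)).mul_left _

variable (R) in
/-- The product of the powers `(1 - X ^ n) ^ e n` over `n ≥ 1`. -/
noncomputable def eulerProd (e : ℕ → ℕ) : R⟦X⟧ := ∏' n, (1 - X ^ (n + 1)) ^ e (n + 1)

theorem eulerProd_congr {e e' : ℕ → ℕ} (h : ∀ n, e (n + 1) = e' (n + 1)) :
    eulerProd R e = eulerProd R e' := by
  simp_rw [eulerProd, h]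

variable [IsTopologicalRing R] [T2Space R]

theorem eulerProd_add (e e' : ℕ → ℕ) :
    eulerProd R (e + e') = eulerProd R e * eulerProd R e' := by
  rw [eulerProd, eulerProd, eulerProd, ← Multipliable.tprod_mul]
  · simp_rw [Pi.add_apply, pow_add]
  all_goals exact multipliable_one_sub_X_pow_pow (fun n => n.le_succ) _

theorem eulerProd_nsmul (k : ℕ) (e : ℕ → ℕ) : eulerProd R (k • e) = eulerProd R e ^ k := by
  induction k with
  | zero => simp [eulerProd]
  | succ k ih => rw [succ_nsmul, eulerProd_add, ih, pow_succ]

theorem constantCoeff_eulerProd (e : ℕ → ℕ) : constantCoeff (eulerProd R e) = 1 := by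
  rw [eulerProd, Multipliable.map_tprod (multipliable_one_sub_X_pow_pow (fun n => n.le_succ) _) _
    (WithPiTopology.continuous_constantCoeff R)]
  simp

theorem isUnit_eulerProd (e : ℕ → ℕ) : IsUnit (eulerProd R e) := by
  rw [isUnit_iff_constantCoeff, constantCoeff_eulerProd]
  exact isUnit_one

/-- Reindexing an Euler product along an injection. -/
theorem tprod_one_sub_X_pow_comp {g : ℕ → ℕ} (hg : Function.Injective g) (hg0 : ∀ n, g n ≠ 0)
    (e e' : ℕ → ℕ) (he : ∀ n, e' (g n) = e n) (he' : ∀ m, m ≠ 0 → e' m ≠ 0 → m ∈ Set.range g) :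
    ∏' n, (1 - X ^ g n : R⟦X⟧) ^ e n = eulerProd R e' := by
  have hinj : Function.Injective fun n => g n - 1 := by
    intro a b hab
    have := hg0 a; have := hg0 b
    exact hg (by simp only at hab; omega)
  rw [eulerProd, ← hinj.tprod_eq (f := fun n => (1 - X ^ (n + 1) : R⟦X⟧) ^ e' (n + 1))]
  · refine tprod_congr fun n => ?_
    simp only [Nat.sub_add_cancel (Nat.one_le_iff_ne_zero.2 (hg0 n)), he]
  · intro m hm
    rw [Function.mem_mulSupport] at hm
    have h0 : e' (m + 1) ≠ 0 := by
      intro h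
      simp [h] at hm
    obtain ⟨n, hn⟩ := he' _ m.succ_ne_zero h0
    exact ⟨n, by simp [hn]⟩

theorem expand_eulerProd {p : ℕ} (hp : p ≠ 0) (e : ℕ → ℕ) :
    expand p hp (eulerProd R e) = eulerProd R fun n => if p ∣ n then e (n / p) else 0 := by
  rw [eulerProd, Multipliable.map_tprod (multipliable_one_sub_X_pow_pow (fun n => n.le_succ) _) _
    (continuous_expand hp)]
  simp only [map_pow, map_sub, map_one, expand_X, ← pow_mul]
  refine tprod_one_sub_X_pow_comp (fun a b h => ?_) (fun n => by positivity) _ _ (fun n => ?_) ?_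
  · have := Nat.eq_of_mul_eq_mul_left (Nat.pos_of_ne_zero hp) h
    omega
  · simp [Nat.pos_of_ne_zero hp]
  · intro m hm h
    simp only [ne_eq, ite_eq_right_iff, Classical.not_imp] at h
    obtain ⟨k, rfl⟩ := h.1
    have : k ≠ 0 := by rintro rfl; simp at hm
    exact ⟨k - 1, congrArg (p * ·) (Nat.sub_add_cancel (Nat.one_le_iff_ne_zero.2 this))⟩

theorem map_eulerProd [IsTopologicalRing S] [T2Space S] {φ : R →+* S} (hφ : Continuous φ)
    (e : ℕ → ℕ) : map φ (eulerProd R e) = eulerProd S e := by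
  rw [eulerProd, Multipliable.map_tprod (multipliable_one_sub_X_pow_pow (fun n => n.le_succ) _) _
    (continuous_map hφ)]
  simp [eulerProd]

/-- The product of `1 - X ^ (d * j + r)` over `j ≥ 0`. -/
theorem tprod_one_sub_X_pow_arith {d r : ℕ} (hr : 0 < r) (hrd : r ≤ d) :
    ∏' j : ℕ, (1 - X ^ (d * j + r) : R⟦X⟧)
      = eulerProd R fun n => if n % d = r % d then 1 else 0 := by
  have hd : 0 < d := hr.trans_le hrd
  have := tprod_one_sub_X_pow_comp (R := R) (g := fun j => d * j + r)
    (e := fun _ => 1) (e' := fun n => if n % d = r % d then 1 else 0) ?_ ?_ ?_ ?_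
  · simpa using this
  · intro a b h
    exact Nat.eq_of_mul_eq_mul_left hd (by simpa using h)
  · intro n; omega
  · intro n; simp [Nat.add_mod]
  · intro m hm h
    have h : m % d = r % d := by simpa using h
    have hle : r ≤ m := by
      rcases hrd.lt_or_eq with hlt | rfl
      · rw [Nat.mod_eq_of_lt hlt] at h
        exact h ▸ Nat.mod_le _ _
      · rw [Nat.mod_self] at h
        exact Nat.le_of_dvd (Nat.pos_of_ne_zero hm) (Nat.dvd_of_mod_eq_zero h)
    obtain ⟨j, hj⟩ := (Nat.modEq_iff_dvd' hle).1 (show r ≡ m [MOD d] from h.symm)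
    exact ⟨j, by simp only; omega⟩

/-- The product of `1 + X ^ (d * j + r)` over `j ≥ 0`. -/
theorem tprod_one_add_X_pow_arith {d r : ℕ} (hr : 0 < r) (hrd : r ≤ d) :
    (∏' j : ℕ, (1 + X ^ (d * j + r) : R⟦X⟧))
      * (eulerProd R fun n => if n % d = r % d then 1 else 0)
      = eulerProd R fun n => if n % (2 * d) = (2 * r) % (2 * d) then 1 else 0 := by
  have hd : 0 < d := hr.trans_le hrd
  have hle : ∀ n, n ≤ d * n + r := fun n => by nlinarith
  rw [← tprod_one_sub_X_pow_arith hr hrd,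
    ← tprod_one_sub_X_pow_arith (by omega : 0 < 2 * r) (by omega : 2 * r ≤ 2 * d),
    ← Multipliable.tprod_mul]
  · refine tprod_congr fun j => ?_
    rw [show 2 * d * j + 2 * r = 2 * (d * j + r) by ring]
    ring
  · simpa using multipliable_one_add_C_mul_X_pow (R := R) hle 1
  · simpa using multipliable_one_sub_X_pow_pow (R := R) hle fun _ => 1

/-- The Euler function at `X ^ m`: the product of `1 - X ^ (m * n)` over `n ≥ 1`. -/
noncomputable def eulerF (m : ℕ) : ℤ⟦X⟧ := eulerProd ℤ fun n => if m ∣ n then 1 else 0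

theorem expand_eulerF {p : ℕ} (hp : p ≠ 0) (m : ℕ) :
    expand p hp (eulerF m) = eulerF (p * m) := by
  rw [eulerF, expand_eulerProd, eulerF]
  refine eulerProd_congr fun n => ?_
  rw [← ite_and]
  refine if_congr ⟨?_, ?_⟩ rfl rfl
  · rintro ⟨⟨a, ha⟩, h⟩
    rw [ha] at h ⊢
    rw [Nat.mul_div_cancel_left _ (Nat.pos_of_ne_zero hp)] at h
    exact Nat.mul_dvd_mul_left p h
  · intro h
    have h1 : p ∣ n + 1 := (Dvd.intro _ rfl).trans h
    exact ⟨h1, (Nat.dvd_div_iff_mul_dvd h1).2 h⟩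

theorem isUnit_eulerF (m : ℕ) : IsUnit (eulerF m) := isUnit_eulerProd _

theorem eulerF_ne_zero (m : ℕ) : eulerF m ≠ 0 := (isUnit_eulerF m).ne_zero

end EulerProducts

/-! ### The q-binomial theorem and a finite triple product -/

section GaussianBinomials

variable {A : Type*} [CommRing A]

/-- The Gaussian binomial coefficient at `q`. -/
def gaussBinom (q : A) : ℕ → ℕ → A
  | _, 0 => 1
  | 0, _ + 1 => 0
  | n + 1, k + 1 => gaussBinom q n k + q ^ (k + 1) * gaussBinom q n (k + 1)

/-- The finite product of `1 - q ^ j` over `1 ≤ j ≤ n`. -/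
def qFactor (q : A) (n : ℕ) : A := ∏ j ∈ Finset.range n, (1 - q ^ (j + 1))

theorem gaussBinom_zero_right (q : A) (n : ℕ) : gaussBinom q n 0 = 1 := by
  cases n <;> rfl

theorem gaussBinom_eq_zero (q : A) {n k : ℕ} (h : n < k) : gaussBinom q n k = 0 := by
  induction n generalizing k with
  | zero =>
    obtain ⟨k, rfl⟩ := Nat.exists_eq_succ_of_ne_zero h.ne'
    rfl
  | succ n ih =>
    obtain ⟨k, rfl⟩ := Nat.exists_eq_succ_of_ne_zero (Nat.ne_of_gt (n.succ_pos.trans h))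
    rw [gaussBinom, ih (by omega), ih (by omega)]
    simp

theorem gaussBinom_self (q : A) (n : ℕ) : gaussBinom q n n = 1 := by
  induction n with
  | zero => rfl
  | succ n ih => rw [gaussBinom, ih, gaussBinom_eq_zero q n.lt_succ_self]; simp

/-- The quotient formula for Gaussian binomials in a division-free form, valid in any commutative
ring. -/
theorem gaussBinom_mul_qFactor (q : A) (k l : ℕ) :
    gaussBinom q (k + l) k * (qFactor q k * qFactor q l) = qFactor q (k + l) := by
  induction k generalizing l with
  | zero => simp [gaussBinom_zero_right, qFactor]
  | succ k ihk =>
    induction l with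
    | zero => simp [gaussBinom_self, qFactor]
    | succ l ihl =>
      have h1 := ihk (l + 1)
      rw [show k + 1 + (l + 1) = (k + 1 + l) + 1 by ring, gaussBinom]
      rw [show k + (l + 1) = k + 1 + l by ring] at h1
      have e : ∀ n, qFactor q (n + 1) = qFactor q n * (1 - q ^ (n + 1)) := fun n =>
        Finset.prod_range_succ _ _
      rw [e (k + 1 + l)]
      rw [e l] at h1 ⊢
      rw [e k] at ihl ⊢
      linear_combination (1 - q ^ (k + 1)) * h1 + q ^ (k + 1) * (1 - q ^ (l + 1)) * ihl

/-- The q-binomial theorem, made homogeneous in x and y so that y can later be a power of q; this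
avoids negative powers of q. -/
theorem prod_add_mul_pow (q x y : A) (n : ℕ) :
    ∏ j ∈ Finset.range n, (y + x * q ^ j)
      = ∑ k ∈ Finset.range (n + 1), q ^ (k.choose 2) * gaussBinom q n k * x ^ k * y ^ (n - k) := by
  induction n generalizing x with
  | zero => simp [gaussBinom]
  | succ n ih =>
    rw [Finset.prod_range_succ']
    have : ∀ j, y + x * q ^ (j + 1) = y + (x * q) * q ^ j := fun j => by ring
    simp only [this, ih, pow_zero, mul_one]
    rw [Finset.sum_range_succ' _ (n + 1), mul_add, Finset.sum_mul, Finset.sum_mul,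
      Finset.sum_range_succ' _ n, Finset.sum_range_succ _ n, Finset.sum_range_succ _ n]
    have hk : ∀ k, q ^ ((k + 1).choose 2) = q ^ (k.choose 2) * q ^ k := fun k => by
      rw [← pow_add, Nat.choose_succ_succ' k 1, Nat.choose_one_right, add_comm]
    have hterm : ∀ k ∈ Finset.range n,
        q ^ ((k + 1).choose 2) * gaussBinom q (n + 1) (k + 1) * x ^ (k + 1) * y ^ (n + 1 - (k + 1))
        = q ^ ((k + 1).choose 2) * gaussBinom q n (k + 1) * (x * q) ^ (k + 1) * y ^ (n - (k + 1)) * y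
          + q ^ (k.choose 2) * gaussBinom q n k * (x * q) ^ k * y ^ (n - k) * x := by
      intro k hk'
      have hlt := Finset.mem_range.1 hk'
      rw [gaussBinom, hk, show n + 1 - (k + 1) = (n - (k + 1)) + 1 by omega,
        show n - k = (n - (k + 1)) + 1 by omega]
      ring
    rw [Finset.sum_congr rfl hterm, Finset.sum_add_distrib, hk n]
    simp only [gaussBinom_zero_right, gaussBinom_self, Nat.sub_self, Nat.sub_zero, Nat.choose_zero_succ]
    ring

/-- The triangular number `n (n + 1) / 2`, for an integer `n`. -/
def triangular (n : ℤ) : ℕ := (n * (n + 1) / 2).toNat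

theorem two_mul_triangular (n : ℤ) : 2 * (triangular n : ℤ) = n * (n + 1) := by
  have h1 : 0 ≤ n * (n + 1) := by
    rcases le_or_gt 0 n with h | h
    · positivity
    · nlinarith
  rw [triangular, Int.toNat_of_nonneg (Int.ediv_nonneg h1 (by norm_num))]
  exact Int.two_mul_ediv_two_of_even (Int.even_mul_succ_self n)

theorem two_mul_choose_two (n : ℕ) : 2 * (n.choose 2 : ℤ) = n * (n - 1) := by
  rw [← Int.two_mul_ediv_two_of_even (Int.even_mul_pred_self (n : ℤ))]
  rcases n with _ | n
  · simp
  · rw [Nat.choose_two_right]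
    push_cast
    simp

/-- Take y = q^N, x = a and 2N factors in the q-binomial theorem. The first N factors turn into 1 +
b q^j and the last N into 1 + a q^j, up to a common monomial that can be cancelled. -/
theorem finite_jacobi_triple_product [IsDomain A] {a b : A} (ha : a ≠ 0) (hb : b ≠ 0) (N : ℕ) :
    (∏ j ∈ Finset.range N, (1 + a * (a * b) ^ j)) * ∏ j ∈ Finset.range N, (1 + b * (a * b) ^ j)
      = ∑ k ∈ Finset.range (2 * N + 1),
          a ^ triangular (k - N) * b ^ triangular (N - k) * gaussBinom (a * b) (2 * N) k := by
  set q := a * b with hq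
  have hprod : ∏ j ∈ Finset.range (2 * N), (q ^ N + a * q ^ j)
      = a ^ N * q ^ (N.choose 2 + N * N) * ((∏ j ∈ Finset.range N, (1 + a * q ^ j))
        * ∏ j ∈ Finset.range N, (1 + b * q ^ j)) := by
    rw [two_mul, Finset.prod_range_add]
    -- Here q^N = q^j (ab) q^(N-1-j), so the factor q^j a comes out and the remaining index is
    -- reversed.
    have h1 : ∏ j ∈ Finset.range N, (q ^ N + a * q ^ j)
        = ∏ j ∈ Finset.range N, (q ^ j * (a * (1 + b * q ^ (N - 1 - j)))) := by
      refine Finset.prod_congr rfl fun j hj => ?_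
      have hj := Finset.mem_range.1 hj
      conv_lhs => rw [show N = j + ((N - 1 - j) + 1) by omega]
      rw [pow_add, pow_succ]
      conv_lhs => rw [hq]
      rw [← hq]
      ring
    have h2 : ∏ j ∈ Finset.range N, (q ^ N + a * q ^ (N + j))
        = ∏ j ∈ Finset.range N, (q ^ N * (1 + a * q ^ j)) :=
      Finset.prod_congr rfl fun j _ => by rw [pow_add]; ring
    rw [h1, h2, Finset.prod_mul_distrib, Finset.prod_mul_distrib, Finset.prod_mul_distrib,
      Finset.prod_range_reflect (fun j => 1 + b * q ^ j) N, Finset.prod_const, Finset.prod_const,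
      Finset.card_range, Finset.prod_pow_eq_pow_sum, Finset.sum_range_id, Nat.choose_two_right,
      pow_add, pow_mul]
    ring
  rw [prod_add_mul_pow] at hprod
  have hne : a ^ N * q ^ (N.choose 2 + N * N) ≠ 0 :=
    mul_ne_zero (pow_ne_zero _ ha) (pow_ne_zero _ (mul_ne_zero ha hb))
  refine mul_left_cancel₀ hne (hprod.symm.trans ?_)
  rw [Finset.mul_sum]
  refine Finset.sum_congr rfl fun k hk => ?_
  have hk : k ≤ 2 * N := Nat.lt_succ_iff.1 (Finset.mem_range.1 hk)
  have e1 := two_mul_triangular ((k : ℤ) - N)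
  have e2 := two_mul_triangular ((N : ℤ) - k)
  have e3 := two_mul_choose_two k
  have e4 := two_mul_choose_two N
  have ea : k.choose 2 + k + N * (2 * N - k)
      = N + (N.choose 2 + N * N) + triangular (k - N) := by
    zify [hk]
    linarith
  have eb : k.choose 2 + N * (2 * N - k) = N.choose 2 + N * N + triangular (N - k) := by
    zify [hk]
    linarith
  have h1 : q ^ k.choose 2 * gaussBinom q (2 * N) k * a ^ k * (q ^ N) ^ (2 * N - k)
      = a ^ (k.choose 2 + k + N * (2 * N - k)) * b ^ (k.choose 2 + N * (2 * N - k))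
        * gaussBinom q (2 * N) k := by
    rw [← pow_mul, pow_add, pow_add, pow_add]
    generalize gaussBinom q (2 * N) k = g
    rw [hq, mul_pow, mul_pow]
    ring
  rw [h1, ea, eb]
  generalize gaussBinom q (2 * N) k = g
  rw [hq, mul_pow]
  ring

end GaussianBinomials

/-! ### Theta series and the Jacobi triple product -/

section TripleProduct

theorem PowerSeries.summable_C_mul_X_pow {ι : Type*} (c : ι → ℤ) (e : ι → ℕ)
    (h : ∀ d, {t | e t = d}.Finite) : Summable fun t => (C (c t) * X ^ e t : ℤ⟦X⟧) := by
  rw [WithPiTopology.summable_iff_summable_coeff]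
  refine fun d => summable_of_hasFiniteSupport ((h d).subset fun t ht => ?_)
  rw [Function.mem_support, coeff_C_mul, coeff_X_pow] at ht
  by_contra hne
  exact ht (by simp [Ne.symm hne])

/-- The exponent of the `n`-th term of a theta series. -/
def thetaExp (i j : ℕ) (n : ℤ) : ℕ := i * triangular n + j * triangular (-n)

/-- Ramanujan's theta series `f(a, b)` for `a = ε X ^ i` and `b = ε X ^ j`, where `ε = ±1`. -/
noncomputable def thetaSeries (ε : ℤ) (i j : ℕ) : ℤ⟦X⟧ :=
  ∑' n : ℤ, C (ε ^ n.natAbs) * X ^ thetaExp i j n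

theorem two_mul_thetaExp (i j : ℕ) (n : ℤ) :
    2 * (thetaExp i j n : ℤ) = i * (n * (n + 1)) + j * (n * (n - 1)) := by
  have h1 := two_mul_triangular n
  have h2 := two_mul_triangular (-n)
  rw [thetaExp]
  push_cast
  linear_combination (i : ℤ) * h1 + (j : ℤ) * h2

/-- A linear lower bound for the exponents: it gives summability and controls the tails in the
triple product. The summand 1 is needed, as i = 1, j = 0, n = -1 shows. -/
theorem natAbs_le_thetaExp {i j : ℕ} (h : 0 < i + j) (n : ℤ) : n.natAbs ≤ thetaExp i j n + 1 := by
  have e := two_mul_thetaExp i j n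
  have h1 : 0 ≤ n * (n + 1) := by rw [← two_mul_triangular]; positivity
  have h2 : 0 ≤ n * (n - 1) := by
    have := two_mul_triangular (-n)
    nlinarith
  have hij : (1 : ℤ) ≤ i ∨ (1 : ℤ) ≤ j := by omega
  have hi : (0 : ℤ) ≤ i := by positivity
  have hj : (0 : ℤ) ≤ j := by positivity
  zify
  rcases hij with h | h <;> rcases le_total 0 n with hn | hn
  · rw [abs_of_nonneg hn]; nlinarith [mul_nonneg hj h2, mul_nonneg (sub_nonneg.2 h) h1]
  · rw [abs_of_nonpos hn]; nlinarith [mul_nonneg hj h2, mul_nonneg (sub_nonneg.2 h) h1, sq_nonneg (n + 1)]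
  · rw [abs_of_nonneg hn]; nlinarith [mul_nonneg hi h1, mul_nonneg (sub_nonneg.2 h) h2, sq_nonneg (n - 1)]
  · rw [abs_of_nonpos hn]; nlinarith [mul_nonneg hi h1, mul_nonneg (sub_nonneg.2 h) h2]

theorem summable_thetaSeries (ε : ℤ) {i j : ℕ} (h : 0 < i + j) :
    Summable fun n : ℤ => (C (ε ^ n.natAbs) * X ^ thetaExp i j n : ℤ⟦X⟧) := by
  refine summable_C_mul_X_pow _ _ fun d => (Set.finite_Icc (-(d + 1) : ℤ) (d + 1)).subset ?_
  rintro n rfl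
  have := natAbs_le_thetaExp h n
  rw [Set.mem_Icc]
  omega

theorem X_pow_dvd_tprod_sub_prod {F : ℕ → ℤ⟦X⟧} (h : ∀ n, X ^ (n + 1) ∣ F n - 1) (m : ℕ) :
    X ^ (m + 1) ∣ ∏' n, F n - ∏ n ∈ Finset.range m, F n := by
  have hF : Multipliable F :=
    multipliable_of_X_pow_dvd fun n => (pow_dvd_pow _ n.le_succ).trans (h n)
  have hr : ∀ k, X ^ (m + 1) ∣ ∏ n ∈ Finset.range (m + k), F n - ∏ n ∈ Finset.range m, F n := by
    intro k
    induction k with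
    | zero => simp
    | succ k ih =>
      rw [← add_assoc, Finset.prod_range_succ]
      have h2 := ((pow_dvd_pow X (by omega : m + 1 ≤ m + k + 1)).trans (h (m + k))).mul_left
        (∏ n ∈ Finset.range (m + k), F n)
      convert dvd_add ih h2 using 1
      ring
  rw [X_pow_dvd_iff]
  intro i hi
  have ht := hF.hasProd.tendsto_prod_nat
  rw [WithPiTopology.tendsto_iff_coeff_tendsto] at ht
  have hconst : Filter.Tendsto (fun n => coeff i (∏ k ∈ Finset.range n, F k)) Filter.atTop
      (nhds (coeff i (∏ n ∈ Finset.range m, F n))) := by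
    refine tendsto_atTop_of_eventually_const (i₀ := m) fun n hn => ?_
    obtain ⟨k, rfl⟩ := Nat.exists_eq_add_of_le hn
    exact sub_eq_zero.1 ((map_sub _ _ _).symm.trans (X_pow_dvd_iff.1 (hr k) i hi))
  rw [map_sub, tendsto_nhds_unique (ht i) hconst, sub_self]

theorem tprod_one_sub_X_pow_mul (d : ℕ) (hd : 0 < d) :
    ∏' n : ℕ, (1 - (X ^ d) ^ (n + 1) : ℤ⟦X⟧) = eulerF d := by
  have := tprod_one_sub_X_pow_arith (R := ℤ) hd le_rfl
  simp only [Nat.mod_self, ← Nat.dvd_iff_mod_eq_zero] at this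
  rw [eulerF, ← this]
  refine tprod_congr fun n => ?_
  rw [← pow_mul, mul_add, mul_one]

theorem X_pow_dvd_eulerF_sub_qFactor {d : ℕ} (hd : 0 < d) {m r : ℕ} (h : m ≤ r) :
    X ^ (m + 1) ∣ eulerF d - qFactor (X ^ d) r := by
  rw [← tprod_one_sub_X_pow_mul d hd, qFactor]
  refine (pow_dvd_pow _ (by omega : m + 1 ≤ r + 1)).trans (X_pow_dvd_tprod_sub_prod (fun n => ?_) r)
  rw [sub_sub_cancel_left, dvd_neg, ← pow_mul]
  exact pow_dvd_pow _ (Nat.le_mul_of_pos_left _ hd)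

/-- In the quotient formula all three q-factorials agree with the infinite product up to order m, so
the Gaussian binomial tends to its reciprocal. -/
theorem X_pow_dvd_gaussBinom_mul_eulerF_sub_one {d : ℕ} (hd : 0 < d) {m k l : ℕ} (hk : m ≤ k)
    (hl : m ≤ l) : X ^ (m + 1) ∣ gaussBinom (X ^ d) (k + l) k * eulerF d - 1 := by
  have h1 := X_pow_dvd_eulerF_sub_qFactor hd hk
  have h2 := X_pow_dvd_eulerF_sub_qFactor hd hl
  have h3 := X_pow_dvd_eulerF_sub_qFactor hd (hk.trans (Nat.le_add_right k l))
  have h4 := gaussBinom_mul_qFactor (X ^ d : ℤ⟦X⟧) k l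
  rw [← ((isUnit_eulerF d).mul (isUnit_eulerF d)).dvd_mul_left (u := eulerF d * eulerF d)]
  set F := eulerF d
  set G := gaussBinom (X ^ d : ℤ⟦X⟧) (k + l) k
  have : F * F * (G * F - 1) = G * F * (F * (F - qFactor (X ^ d) k)
      + qFactor (X ^ d) k * (F - qFactor (X ^ d) l)) - F * (F - qFactor (X ^ d) (k + l)) := by
    linear_combination F * h4
  rw [this]
  exact ((h1.mul_left _).add (h2.mul_left _) |>.mul_left _).sub (h3.mul_left _)

/-- Let N tend to infinity in the finite identity for a = εX^i, b = εX^j, multiplied by `eulerF (i +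
j)`. Coefficients are compared one at a time. -/
theorem jacobi_triple_product {ε : ℤ} (hε : ε * ε = 1) {i j : ℕ} (h : 0 < i + j) :
    thetaSeries ε i j = (∏' n : ℕ, (1 + C ε * X ^ ((i + j) * n + i)))
      * (∏' n : ℕ, (1 + C ε * X ^ ((i + j) * n + j))) * eulerF (i + j) := by
  have hpow : ∀ k, ε ^ (2 * k) = 1 := fun k => by rw [pow_mul, pow_two, hε, one_pow]
  set a : ℤ⟦X⟧ := C ε * X ^ i with ha
  set b : ℤ⟦X⟧ := C ε * X ^ j with hb
  have hCC : (C ε * C ε : ℤ⟦X⟧) = 1 := by rw [← map_mul, hε, map_one]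
  have hC : (C ε : ℤ⟦X⟧) ≠ 0 := left_ne_zero_of_mul (hCC.trans_ne one_ne_zero)
  have ha0 : a ≠ 0 := mul_ne_zero hC (pow_ne_zero _ X_ne_zero)
  have hb0 : b ≠ 0 := mul_ne_zero hC (pow_ne_zero _ X_ne_zero)
  have hab : a * b = X ^ (i + j) := by
    rw [ha, hb, pow_add]
    linear_combination (X ^ i * X ^ j) * hCC
  have hterm : ∀ n : ℤ, a ^ triangular n * b ^ triangular (-n)
      = C (ε ^ n.natAbs) * X ^ thetaExp i j n := by
    intro n
    have he : ε ^ (triangular n + triangular (-n)) = ε ^ n.natAbs := by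
      have : triangular n + triangular (-n) = n.natAbs * n.natAbs := by
        have h1 := two_mul_triangular n
        have h2 := two_mul_triangular (-n)
        zify
        rw [abs_mul_abs_self]
        linarith
      rw [this]
      rcases Nat.even_or_odd n.natAbs with ⟨k, hk⟩ | ⟨k, hk⟩
      · rw [hk, ← two_mul, mul_assoc, hpow, hpow]
      · rw [hk, show (2 * k + 1) * (2 * k + 1) = 2 * (2 * k * k + 2 * k) + 1 by ring, pow_succ,
          pow_succ, hpow, hpow]
    rw [ha, hb, mul_pow, mul_pow, ← pow_mul, ← pow_mul, thetaExp, ← he, map_pow, pow_add, pow_add]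
    ring
  have hle : ∀ r n, n ≤ (i + j) * n + r := fun r n =>
    (Nat.le_mul_of_pos_left _ h).trans (Nat.le_add_right _ _)
  have hlim : Filter.Tendsto (fun N : ℕ => (∏ n ∈ Finset.range N, (1 + a * (a * b) ^ n))
      * (∏ n ∈ Finset.range N, (1 + b * (a * b) ^ n)) * eulerF (i + j)) Filter.atTop
      (nhds ((∏' n : ℕ, (1 + C ε * X ^ ((i + j) * n + i)))
      * (∏' n : ℕ, (1 + C ε * X ^ ((i + j) * n + j))) * eulerF (i + j))) := by
    have e : ∀ r n, (1 + C ε * X ^ ((i + j) * n + r) : ℤ⟦X⟧) = 1 + C ε * X ^ r * (a * b) ^ n := by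
      intro r n
      rw [hab, pow_add, ← pow_mul]
      ring
    have h1 := (multipliable_one_add_C_mul_X_pow (hle i) ε).hasProd.tendsto_prod_nat
    have h2 := (multipliable_one_add_C_mul_X_pow (hle j) ε).hasProd.tendsto_prod_nat
    simp only [e] at h1 h2 ⊢
    exact (h1.mul h2).mul_const _
  have hsum : Filter.Tendsto (fun N : ℕ => ∑ n ∈ Finset.Icc (-N : ℤ) N,
      (C (ε ^ n.natAbs) * X ^ thetaExp i j n : ℤ⟦X⟧)) Filter.atTop (nhds (thetaSeries ε i j)) := by
    refine (summable_thetaSeries ε h).hasSum.comp (Filter.tendsto_atTop_finset_of_monotone ?_ ?_)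
    · intro M N hMN
      refine Finset.Icc_subset_Icc ?_ ?_ <;> omega
    · intro n
      exact ⟨n.natAbs, by rw [Finset.mem_Icc]; omega⟩
  rw [WithPiTopology.tendsto_iff_coeff_tendsto] at hlim hsum
  refine PowerSeries.ext fun m => tendsto_nhds_unique (hsum m) ((hlim m).congr' ?_)
  -- Write l = 2N - k. The k-th term has order at least |k - N| - 1, and its Gaussian binomial has
  -- error of order at least min(k, l) + 1. As |k - N| + min(k, l) = N, the two sides agree below
  -- order N, hence at m.
  refine Filter.eventually_atTop.2 ⟨m + 1, fun N hN => ?_⟩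
  have hIcc : ∑ n ∈ Finset.Icc (-N : ℤ) N, (C (ε ^ n.natAbs) * X ^ thetaExp i j n : ℤ⟦X⟧)
      = ∑ k ∈ Finset.range (2 * N + 1), a ^ triangular (k - N) * b ^ triangular (N - k) := by
    symm
    refine Finset.sum_bij (fun k _ => (k : ℤ) - N) ?_ ?_ ?_ ?_
    · intro k hk
      have := Finset.mem_range.1 hk
      rw [Finset.mem_Icc]
      omega
    · intro k _ l _ hkl
      omega
    · intro n hn
      rw [Finset.mem_Icc] at hn
      exact ⟨(n + N).toNat, Finset.mem_range.2 (by omega), by omega⟩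
    · intro k _
      rw [← hterm, neg_sub]
  beta_reduce
  rw [finite_jacobi_triple_product ha0 hb0, hIcc, ← sub_eq_zero, ← map_sub, Finset.sum_mul,
    ← Finset.sum_sub_distrib]
  refine X_pow_dvd_iff.1 (Finset.dvd_sum fun k hk => ?_) m hN
  have hk := Finset.mem_range.1 hk
  obtain ⟨l, hl⟩ : ∃ l, k + l = 2 * N := ⟨2 * N - k, by omega⟩
  have hd := X_pow_dvd_gaussBinom_mul_eulerF_sub_one h (min_le_left k l) (min_le_right k l)
  rw [hl, ← hab] at hd
  have hn := natAbs_le_thetaExp h ((k : ℤ) - N)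
  have ht : X ^ thetaExp i j ((k : ℤ) - N) ∣ a ^ triangular (k - N) * b ^ triangular (N - k) := by
    have := hterm ((k : ℤ) - N)
    rw [neg_sub] at this
    rw [this]
    exact Dvd.intro_left _ rfl
  have := mul_dvd_mul ht hd
  rw [← pow_add] at this
  refine (pow_dvd_pow X ?_).trans (this.trans (dvd_of_eq (by ring)))
  have : ((k : ℤ) - N).natAbs + min k l = N := by omega
  omega

end TripleProduct

/-! ### Product formulas and quadratic identities for theta series -/

section ThetaProducts

/-- The product of `1 - X ^ n` over the `n ≥ 1` congruent to `r` modulo `d`. -/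
noncomputable def eulerResidue (d r : ℕ) : ℤ⟦X⟧ :=
  eulerProd ℤ fun n => if n % d = r % d then 1 else 0

theorem thetaSeries_one_mul {i j : ℕ} (hi : 0 < i) (hj : 0 < j) :
    thetaSeries 1 i j * (eulerResidue (i + j) i * eulerResidue (i + j) j)
      = eulerResidue (2 * (i + j)) (2 * i) * eulerResidue (2 * (i + j)) (2 * j)
        * eulerF (i + j) := by
  rw [jacobi_triple_product (by norm_num) (by omega)]
  have h1 := tprod_one_add_X_pow_arith (R := ℤ) hi (Nat.le_add_right i j)
  have h2 := tprod_one_add_X_pow_arith (R := ℤ) hj (Nat.le_add_left j i)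
  simp only [map_one, one_mul]
  simp only [eulerResidue]
  rw [← h1, ← h2]
  ring

theorem thetaSeries_neg_one {i j : ℕ} (hi : 0 < i) (hj : 0 < j) :
    thetaSeries (-1) i j
      = eulerResidue (i + j) i * eulerResidue (i + j) j * eulerF (i + j) := by
  rw [jacobi_triple_product (by norm_num) (by omega)]
  have h1 := tprod_one_sub_X_pow_arith (R := ℤ) hi (Nat.le_add_right i j)
  have h2 := tprod_one_sub_X_pow_arith (R := ℤ) hj (Nat.le_add_left j i)
  simp only [map_neg, map_one, neg_mul, one_mul, ← sub_eq_add_neg]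
  rw [h1, h2]
  rfl

/-- The factor 2 is the n = 0 factor 1 + X^0 of the triple product. -/
theorem thetaSeries_one_one_zero_mul : thetaSeries 1 1 0 * eulerF 1 = 2 * eulerF 2 ^ 2 := by
  rw [jacobi_triple_product (by norm_num) (by norm_num)]
  have h1 := tprod_one_add_X_pow_arith (R := ℤ) one_pos le_rfl
  have hz : ∏' n : ℕ, (1 + X ^ n : ℤ⟦X⟧) = 2 * ∏' n : ℕ, (1 + X ^ (n + 1) : ℤ⟦X⟧) := by
    rw [tprod_eq_zero_mul']
    · norm_num
    · simpa using multipliable_one_add_C_mul_X_pow (R := ℤ) (fun n => n.le_succ) 1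
  have e1 : (eulerProd ℤ fun n => if n % 1 = 1 % 1 then 1 else 0) = eulerF 1 :=
    eulerProd_congr fun n => by simp [Nat.mod_one]
  have e2 : (eulerProd ℤ fun n => if n % (2 * 1) = (2 * 1) % (2 * 1) then 1 else 0) = eulerF 2 :=
    eulerProd_congr fun n => by simp [Nat.dvd_iff_mod_eq_zero]
  rw [e1, e2] at h1
  simp only [map_one, one_mul, add_zero] at h1 ⊢
  rw [hz]
  linear_combination 2 * ((∏' n : ℕ, (1 + X ^ (n + 1) : ℤ⟦X⟧)) * eulerF 1 + eulerF 2) * h1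

theorem thetaSeries_neg_one_one_one_mul : thetaSeries (-1) 1 1 * eulerF 2 = eulerF 1 ^ 2 := by
  rw [thetaSeries_neg_one one_pos one_pos, one_add_one_eq_two]
  have h : eulerResidue 2 1 * eulerF 2 = eulerF 1 := by
    rw [eulerResidue, eulerF, eulerF, ← eulerProd_add]
    refine eulerProd_congr fun n => ?_
    simp only [Pi.add_apply, Nat.dvd_iff_mod_eq_zero]
    split_ifs <;> omega
  rw [← h]
  ring

theorem thetaSeries_one_two_three_mul_one_four :
    thetaSeries 1 2 3 * thetaSeries 1 1 4 * (eulerF 1 * eulerF 10) = eulerF 2 * eulerF 5 ^ 3 := by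
  have h1 := thetaSeries_one_mul (i := 2) (j := 3) (by norm_num) (by norm_num)
  have h2 := thetaSeries_one_mul (i := 1) (j := 4) (by norm_num) (by norm_num)
  norm_num at h1 h2
  -- The nonzero residues modulo 5 together with the multiples of 5 exhaust the positive integers;
  -- the same count of residue classes justifies `h4`.
  have h3 : eulerResidue 5 2 * eulerResidue 5 3 * (eulerResidue 5 1 * eulerResidue 5 4) * eulerF 5
      = eulerF 1 := by
    simp only [eulerResidue, eulerF, ← eulerProd_add]
    refine eulerProd_congr fun n => ?_
    simp only [Pi.add_apply, Nat.dvd_iff_mod_eq_zero, Nat.mod_one]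
    split_ifs <;> omega
  have h4 : eulerResidue 10 4 * eulerResidue 10 6 * (eulerResidue 10 2 * eulerResidue 10 8)
      * eulerF 10 = eulerF 2 := by
    simp only [eulerResidue, eulerF, ← eulerProd_add]
    refine eulerProd_congr fun n => ?_
    simp only [Pi.add_apply, Nat.dvd_iff_mod_eq_zero]
    split_ifs <;> omega
  rw [← h3, ← h4]
  linear_combination (thetaSeries 1 1 4 * (eulerResidue 5 1 * eulerResidue 5 4) * eulerF 5
      * eulerF 10) * h1
    + (eulerResidue 10 4 * eulerResidue 10 6 * eulerF 5 ^ 2 * eulerF 10) * h2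

theorem thetaSeries_neg_one_one_nine_mul_three_seven :
    thetaSeries (-1) 1 9 * thetaSeries (-1) 3 7 * (eulerF 2 * eulerF 5)
      = eulerF 1 * eulerF 10 ^ 3 := by
  rw [thetaSeries_neg_one (by norm_num) (by norm_num),
    thetaSeries_neg_one (by norm_num) (by norm_num)]
  norm_num
  have h : eulerResidue 10 1 * eulerResidue 10 9 * (eulerResidue 10 3 * eulerResidue 10 7)
      * (eulerF 2 * eulerF 5) = eulerF 1 * eulerF 10 := by
    simp only [eulerResidue, eulerF, ← eulerProd_add]
    refine eulerProd_congr fun n => ?_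
    simp only [Pi.add_apply, Nat.dvd_iff_mod_eq_zero, Nat.mod_one]
    split_ifs <;> omega
  linear_combination eulerF 10 ^ 2 * h

theorem summable_thetaSeries_mul (ε : ℤ) {i j k l : ℕ} (h : 0 < i + j) (h' : 0 < k + l) :
    Summable fun p : ℤ × ℤ => (C (ε ^ (p.1.natAbs + p.2.natAbs))
      * X ^ (thetaExp i j p.1 + thetaExp k l p.2) : ℤ⟦X⟧) := by
  refine summable_C_mul_X_pow _ _ fun d => ((Set.finite_Icc (-(d + 1) : ℤ) (d + 1)).prod
    (Set.finite_Icc (-(d + 1) : ℤ) (d + 1))).subset ?_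
  rintro ⟨m, n⟩ rfl
  have h1 := natAbs_le_thetaExp h m
  have h2 := natAbs_le_thetaExp h' n
  simp only [Set.mem_prod, Set.mem_Icc]
  omega

theorem thetaSeries_mul (ε : ℤ) {i j k l : ℕ} (h : 0 < i + j) (h' : 0 < k + l) :
    thetaSeries ε i j * thetaSeries ε k l = ∑' p : ℤ × ℤ, C (ε ^ (p.1.natAbs + p.2.natAbs))
      * X ^ (thetaExp i j p.1 + thetaExp k l p.2) := by
  have e : ∀ p : ℤ × ℤ, (C (ε ^ (p.1.natAbs + p.2.natAbs))
      * X ^ (thetaExp i j p.1 + thetaExp k l p.2) : ℤ⟦X⟧)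
      = (C (ε ^ p.1.natAbs) * X ^ thetaExp i j p.1)
        * (C (ε ^ p.2.natAbs) * X ^ thetaExp k l p.2) := by
    intro p
    rw [pow_add, pow_add, map_mul]
    ring
  have hs := summable_thetaSeries_mul ε h h'
  simp only [e] at hs ⊢
  exact (summable_thetaSeries ε h).tsum_mul_tsum (summable_thetaSeries ε h') hs

theorem expand_thetaSeries {p : ℕ} (hp : p ≠ 0) (ε : ℤ) {i j : ℕ} (h : 0 < i + j) :
    expand p hp (thetaSeries ε i j) = thetaSeries ε (p * i) (p * j) := by
  rw [thetaSeries, (summable_thetaSeries ε h).map_tsum _ (continuous_expand hp)]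
  refine tsum_congr fun n => ?_
  rw [map_mul, expand_C, map_pow (expand p hp), expand_X, ← pow_mul, thetaExp, thetaExp]
  congr 2
  ring

theorem tsum_eq_sum_tsum_of_bijective {ι τ κ : Type*} [Fintype τ] {f : ι → ℤ⟦X⟧} (hf : Summable f)
    {g : τ → κ → ι} (hg : Function.Bijective fun p : τ × κ => g p.1 p.2) :
    ∑' p, f p = ∑ t, ∑' p, f (g t p) := by
  have hs : Summable fun p : τ × κ => f (g p.1 p.2) :=
    hf.comp_injective (i := fun p : τ × κ => g p.1 p.2) hg.injective
  have hinj : ∀ t, Function.Injective (g t) := fun t p q h => by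
    have := hg.injective (a₁ := (t, p)) (a₂ := (t, q)) h
    simpa using this
  rw [← (Equiv.ofBijective _ hg).tsum_eq]
  simp only [Equiv.ofBijective_apply]
  rw [hs.tsum_prod' fun t => hf.comp_injective (hinj t), tsum_fintype]

/-- The affine maps that split the pairs of integers according to the classes modulo `2 + i` of
the Gaussian integers `(2 m + 1) + (2 n + 1) i`. -/
def psiCosets : Fin 5 → ℤ × ℤ → ℤ × ℤ
  | 0, (s, r) => (-2 * s - r, -2 * r + s)
  | 1, (s, r) => (-2 * r + s, 2 * s + r - 1)
  | 2, (s, r) => (2 * s + r + 1, 2 * r - s)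
  | 3, (s, r) => (2 * r - s - 1, -2 * s - r)
  | 4, (s, r) => (2 * s + r - 1, 2 * r - s - 1)

theorem psiCosets_bijective :
    Function.Bijective fun p : Fin 5 × (ℤ × ℤ) => psiCosets p.1 p.2 := by
  constructor
  · rintro ⟨t, s, r⟩ ⟨t', s', r'⟩ h
    fin_cases t <;> fin_cases t' <;> simp [psiCosets] at h ⊢ <;> omega
  · rintro ⟨m, n⟩
    have h : (2 * m - n) % 5 = 0 ∨ (2 * m - n) % 5 = 1 ∨ (2 * m - n) % 5 = 2
        ∨ (2 * m - n) % 5 = 3 ∨ (2 * m - n) % 5 = 4 := by omega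
    rcases h with h | h | h | h | h
    · exact ⟨⟨0, -((2 * m - n) / 5), -((m + 2 * n) / 5)⟩, by simp [psiCosets]; omega⟩
    · exact ⟨⟨1, (m + 2 * n + 2) / 5, -((2 * m - n) / 5)⟩, by simp [psiCosets]; omega⟩
    · exact ⟨⟨2, (2 * m - n) / 5, (m + 2 * n) / 5⟩, by simp [psiCosets]; omega⟩
    · exact ⟨⟨3, -((m + 2 * n + 1) / 5), (2 * m - n) / 5 + 1⟩, by simp [psiCosets]; omega⟩
    · exact ⟨⟨4, (2 * m - n) / 5 + 1, (m + 2 * n) / 5 + 1⟩, by simp [psiCosets]; omega⟩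

/-- The exponent T(m) + T(n), with T(n) = n(n+1)/2, is a shifted norm of the Gaussian integer (2m+1)
+ (2n+1)i. Splitting modulo a Gaussian prime of norm 5, the multiples of the prime give the last
term, and the four other classes contribute equally. -/
theorem thetaSeries_one_one_zero_sq :
    thetaSeries 1 1 0 ^ 2 = 4 * (thetaSeries 1 2 3 * thetaSeries 1 1 4)
      + X * thetaSeries 1 5 0 ^ 2 := by
  have hs := summable_thetaSeries_mul 1 (i := 1) (j := 0) (k := 1) (l := 0) (by norm_num)
    (by norm_num)
  have hc := summable_thetaSeries_mul 1 (i := 5) (j := 0) (k := 5) (l := 0) (by norm_num)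
    (by norm_num)
  rw [pow_two, pow_two, thetaSeries_mul 1 (by norm_num) (by norm_num),
    thetaSeries_mul 1 (by norm_num) (by norm_num), thetaSeries_mul 1 (by norm_num) (by norm_num),
    tsum_eq_sum_tsum_of_bijective hs psiCosets_bijective, Fin.sum_univ_five, ← hc.tsum_mul_left]
  simp only [one_pow, map_one, one_mul]
  -- Exponents are compared after doubling, which turns them into integer polynomials in s and r; c
  -- is the shift of the class.
  have key : ∀ (t : Fin 5) (c : ℕ) (e : ℤ → ℤ → ℕ),
      (∀ s r, (2 : ℤ) * e s r + 2 * c = 2 * (thetaExp 1 0 (psiCosets t (s, r)).1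
        + thetaExp 1 0 (psiCosets t (s, r)).2 : ℕ)) → ∀ p : ℤ × ℤ,
      (X ^ (thetaExp 1 0 (psiCosets t p).1 + thetaExp 1 0 (psiCosets t p).2) : ℤ⟦X⟧)
        = X ^ c * X ^ e p.1 p.2 := by
    rintro t c e h ⟨s, r⟩
    rw [← pow_add]
    congr 1
    have := h s r
    simp only
    omega
  have h0 := key 0 0 (fun s r => thetaExp 2 3 s + thetaExp 1 4 r) fun s r => by
    simp only [psiCosets]; push_cast; simp only [mul_add, two_mul_thetaExp]; push_cast; ring
  have h1 := key 1 0 (fun s r => thetaExp 2 3 s + thetaExp 1 4 r) fun s r => by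
    simp only [psiCosets]; push_cast; simp only [mul_add, two_mul_thetaExp]; push_cast; ring
  have h2 := key 2 1 (fun s r => thetaExp 5 0 s + thetaExp 5 0 r) fun s r => by
    simp only [psiCosets]; push_cast; simp only [mul_add, two_mul_thetaExp]; push_cast; ring
  have h3 := key 3 0 (fun s r => thetaExp 2 3 s + thetaExp 1 4 r) fun s r => by
    simp only [psiCosets]; push_cast; simp only [mul_add, two_mul_thetaExp]; push_cast; ring
  have h4 := key 4 0 (fun s r => thetaExp 2 3 s + thetaExp 1 4 r) fun s r => by
    simp only [psiCosets]; push_cast; simp only [mul_add, two_mul_thetaExp]; push_cast; ring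
  simp only [h0, h1, h2, h3, h4, pow_zero, pow_one, one_mul]
  ring

/-- The affine maps that split the Gaussian integers `m + n i` according to their classes modulo
`2 + i`. -/
def phiCosets : Fin 5 → ℤ × ℤ → ℤ × ℤ
  | 0, (s, r) => (2 * s + r, 2 * r - s)
  | 1, (s, r) => (-2 * r + s, 2 * s + r - 1)
  | 2, (s, r) => (-2 * s - r + 1, -2 * r + s)
  | 3, (s, r) => (2 * s + r - 1, 2 * r - s)
  | 4, (s, r) => (2 * r - s, -2 * s - r + 1)

theorem phiCosets_bijective :
    Function.Bijective fun p : Fin 5 × (ℤ × ℤ) => phiCosets p.1 p.2 := by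
  constructor
  · rintro ⟨t, s, r⟩ ⟨t', s', r'⟩ h
    fin_cases t <;> fin_cases t' <;> simp [phiCosets] at h ⊢ <;> omega
  · rintro ⟨m, n⟩
    have h : (2 * m - n) % 5 = 0 ∨ (2 * m - n) % 5 = 1 ∨ (2 * m - n) % 5 = 2
        ∨ (2 * m - n) % 5 = 3 ∨ (2 * m - n) % 5 = 4 := by omega
    rcases h with h | h | h | h | h
    · exact ⟨⟨0, (2 * m - n) / 5, (m + 2 * n) / 5⟩, by simp [phiCosets]; omega⟩
    · exact ⟨⟨1, (m + 2 * n + 2) / 5, -((2 * m - n) / 5)⟩, by simp [phiCosets]; omega⟩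
    · exact ⟨⟨2, -((2 * m - n) / 5), -((m + 2 * n) / 5)⟩, by simp [phiCosets]; omega⟩
    · exact ⟨⟨3, (2 * m - n) / 5 + 1, (m + 2 * n) / 5 + 1⟩, by simp [phiCosets]; omega⟩
    · exact ⟨⟨4, -((m + 2 * n) / 5), (2 * m - n) / 5 + 1⟩, by simp [phiCosets]; omega⟩

/-- The same splitting for the norm m^2 + n^2 with sign (-1)^(m+n). The zero class keeps the parity
of the coordinate sum, and the four others reverse it and shift the exponent by 1, whence the factor
-4X. -/
theorem thetaSeries_neg_one_one_one_sq :
    thetaSeries (-1) 1 1 ^ 2 = thetaSeries (-1) 5 5 ^ 2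
      - 4 * X * (thetaSeries (-1) 1 9 * thetaSeries (-1) 3 7) := by
  have hs := summable_thetaSeries_mul (-1) (i := 1) (j := 1) (k := 1) (l := 1) (by norm_num)
    (by norm_num)
  have hc := summable_thetaSeries_mul (-1) (i := 1) (j := 9) (k := 3) (l := 7) (by norm_num)
    (by norm_num)
  rw [pow_two, pow_two, thetaSeries_mul (-1) (by norm_num) (by norm_num),
    thetaSeries_mul (-1) (by norm_num) (by norm_num),
    thetaSeries_mul (-1) (by norm_num) (by norm_num),
    tsum_eq_sum_tsum_of_bijective hs phiCosets_bijective, Fin.sum_univ_five]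
  have key : ∀ t : Fin 5, t ≠ 0 → ∀ p : ℤ × ℤ,
      (C ((-1) ^ ((phiCosets t p).1.natAbs + (phiCosets t p).2.natAbs))
        * X ^ (thetaExp 1 1 (phiCosets t p).1 + thetaExp 1 1 (phiCosets t p).2) : ℤ⟦X⟧)
        = -X * (C ((-1) ^ (p.1.natAbs + p.2.natAbs))
          * X ^ (thetaExp 1 9 p.1 + thetaExp 3 7 p.2)) := by
    rintro t ht ⟨s, r⟩
    have he : (2 : ℤ) * (thetaExp 1 1 (phiCosets t (s, r)).1
        + thetaExp 1 1 (phiCosets t (s, r)).2 : ℕ)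
        = 2 * (thetaExp 1 9 s + thetaExp 3 7 r + 1 : ℕ) := by
      push_cast
      simp only [mul_add, two_mul_thetaExp]
      fin_cases t
      · exact absurd rfl ht
      all_goals simp only [phiCosets]; push_cast; ring
    have hp : ((phiCosets t (s, r)).1.natAbs + (phiCosets t (s, r)).2.natAbs) % 2
        = (s.natAbs + r.natAbs + 1) % 2 := by
      fin_cases t
      · exact absurd rfl ht
      all_goals simp only [phiCosets]; omega
    rw [show thetaExp 1 1 (phiCosets t (s, r)).1 + thetaExp 1 1 (phiCosets t (s, r)).2
      = thetaExp 1 9 s + thetaExp 3 7 r + 1 by omega, neg_one_pow_eq_pow_mod_two, hp,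
      ← neg_one_pow_eq_pow_mod_two, pow_succ, pow_succ (X : ℤ⟦X⟧)]
    simp only [mul_neg, mul_one, map_neg]
    ring
  have h0 : ∀ p : ℤ × ℤ, (C ((-1) ^ ((phiCosets 0 p).1.natAbs + (phiCosets 0 p).2.natAbs))
        * X ^ (thetaExp 1 1 (phiCosets 0 p).1 + thetaExp 1 1 (phiCosets 0 p).2) : ℤ⟦X⟧)
        = C ((-1) ^ (p.1.natAbs + p.2.natAbs)) * X ^ (thetaExp 5 5 p.1 + thetaExp 5 5 p.2) := by
    rintro ⟨s, r⟩
    have he : (2 : ℤ) * (thetaExp 1 1 (phiCosets 0 (s, r)).1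
        + thetaExp 1 1 (phiCosets 0 (s, r)).2 : ℕ)
        = 2 * (thetaExp 5 5 s + thetaExp 5 5 r : ℕ) := by
      push_cast
      simp only [mul_add, two_mul_thetaExp]
      simp only [phiCosets]
      push_cast
      ring
    have hp : ((phiCosets 0 (s, r)).1.natAbs + (phiCosets 0 (s, r)).2.natAbs) % 2
        = (s.natAbs + r.natAbs) % 2 := by
      simp only [phiCosets]
      omega
    rw [show thetaExp 1 1 (phiCosets 0 (s, r)).1 + thetaExp 1 1 (phiCosets 0 (s, r)).2
      = thetaExp 5 5 s + thetaExp 5 5 r by omega, neg_one_pow_eq_pow_mod_two, hp,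
      ← neg_one_pow_eq_pow_mod_two]
  simp only [h0, key 1 (by decide), key 2 (by decide), key 3 (by decide), key 4 (by decide),
    hc.tsum_mul_left]
  ring

end ThetaProducts

/-! ### The function ψ and its 5-dissection -/

section Dissection

/-- The inverse of the Euler function at `X ^ m`. -/
noncomputable def eulerFInv (m : ℕ) : ℤ⟦X⟧ := ↑(isUnit_eulerF m).unit⁻¹

theorem eulerF_mul_inv (m : ℕ) : eulerF m * eulerFInv m = 1 :=
  (isUnit_eulerF m).mul_val_inv

/-- Ramanujan's theta function `ψ`, the sum of `X ^ (n (n + 1) / 2)` over `n ≥ 0`. -/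
noncomputable def psi : ℤ⟦X⟧ := eulerF 2 ^ 2 * eulerFInv 1

/-- The substitution of `X ^ 5` for `X`. -/
noncomputable def expandFive : ℤ⟦X⟧ →ₐ[ℤ] ℤ⟦X⟧ := expand 5 (by norm_num)

theorem expandFive_eulerF (m : ℕ) : expandFive (eulerF m) = eulerF (5 * m) := expand_eulerF _ m

theorem expandFive_thetaSeries (ε : ℤ) {i j : ℕ} (h : 0 < i + j) :
    expandFive (thetaSeries ε i j) = thetaSeries ε (5 * i) (5 * j) := expand_thetaSeries _ ε h

theorem PowerSeries.ofNat_ne_zero_int (n : ℕ) [n.AtLeastTwo] : (ofNat(n) : ℤ⟦X⟧) ≠ 0 := fun h => by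
  have := congrArg constantCoeff h
  rw [map_ofNat, map_zero] at this
  exact OfNat.ofNat_ne_zero n this

theorem psi_mul_eulerF : psi * eulerF 1 = eulerF 2 ^ 2 := by
  rw [psi, mul_assoc, mul_comm (eulerFInv 1), eulerF_mul_inv, mul_one]

theorem thetaSeries_one_one_zero : thetaSeries 1 1 0 = 2 * psi := by
  refine mul_right_cancel₀ (eulerF_ne_zero 1) ?_
  rw [thetaSeries_one_one_zero_mul, mul_assoc, psi_mul_eulerF]

theorem expandFive_psi_mul_eulerF : expandFive psi * eulerF 5 = eulerF 10 ^ 2 := by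
  simpa [expandFive_eulerF] using congrArg expandFive psi_mul_eulerF

theorem psi_sq : psi ^ 2 = thetaSeries 1 2 3 * thetaSeries 1 1 4 + X * expandFive psi ^ 2 := by
  have h := thetaSeries_one_one_zero_sq
  have h5 : thetaSeries 1 5 0 = 2 * expandFive psi := by
    have := congrArg expandFive thetaSeries_one_one_zero
    rwa [expandFive_thetaSeries _ (by norm_num), map_mul, map_ofNat] at this
  rw [h5, thetaSeries_one_one_zero] at h
  refine mul_left_cancel₀ (ofNat_ne_zero_int 4) ?_
  linear_combination h

theorem psi_sq_sub_mul :
    (psi ^ 2 - X * expandFive psi ^ 2) * (eulerF 1 * eulerF 10) = eulerF 2 * eulerF 5 ^ 3 := by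
  rw [← thetaSeries_one_two_three_mul_one_four, psi_sq]
  ring

/-- The affine maps that split the integers according to the exponent `n (n + 1) / 2` modulo `5`. -/
def triangularCosets : Fin 5 → ℤ → ℤ
  | 0, k => -5 * k
  | 1, k => -5 * k + 1
  | 2, k => 5 * k + 2
  | 3, k => 5 * k - 2
  | 4, k => 5 * k - 1

theorem triangularCosets_bijective :
    Function.Bijective fun p : Fin 5 × ℤ => triangularCosets p.1 p.2 := by
  constructor
  · rintro ⟨t, s⟩ ⟨t', s'⟩ h
    fin_cases t <;> fin_cases t' <;> simp [triangularCosets] at h ⊢ <;> omega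
  · intro n
    have h : n % 5 = 0 ∨ n % 5 = 1 ∨ n % 5 = 2 ∨ n % 5 = 3 ∨ n % 5 = 4 := by omega
    rcases h with h | h | h | h | h
    · exact ⟨⟨0, -(n / 5)⟩, by simp [triangularCosets]; omega⟩
    · exact ⟨⟨1, -(n / 5)⟩, by simp [triangularCosets]; omega⟩
    · exact ⟨⟨2, n / 5⟩, by simp [triangularCosets]; omega⟩
    · exact ⟨⟨3, n / 5 + 1⟩, by simp [triangularCosets]; omega⟩
    · exact ⟨⟨4, n / 5 + 1⟩, by simp [triangularCosets]; omega⟩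

/-- Triangular numbers are 0, 1 or 3 modulo 5. The reflection n ↦ -1 - n preserves them and pairs
off four of the classes of n modulo 5; the class of 2 is its own mirror image and gives the term in
X^3. -/
theorem psi_dissection :
    psi = X ^ 3 * expandFive (expandFive psi) + expandFive (thetaSeries 1 2 3)
      + X * expandFive (thetaSeries 1 1 4) := by
  have h25 : thetaSeries 1 25 0 = 2 * expandFive (expandFive psi) := by
    have := congrArg expandFive (congrArg expandFive thetaSeries_one_one_zero)
    rwa [expandFive_thetaSeries _ (by norm_num), expandFive_thetaSeries _ (by norm_num), map_mul,
      map_mul, map_ofNat, map_ofNat] at this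
  have hs := summable_thetaSeries 1 (i := 1) (j := 0) (by norm_num)
  have key : ∀ (t : Fin 5) (c i j : ℕ), 0 < i + j → (∀ s : ℤ, (2 : ℤ) * thetaExp i j s + 2 * c
      = 2 * thetaExp 1 0 (triangularCosets t s)) →
      ∑' s : ℤ, (C (1 ^ (triangularCosets t s).natAbs)
        * X ^ thetaExp 1 0 (triangularCosets t s) : ℤ⟦X⟧) = X ^ c * thetaSeries 1 i j := by
    intro t c i j hij h
    rw [thetaSeries, ← (summable_thetaSeries 1 hij).tsum_mul_left]
    refine tsum_congr fun s => ?_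
    have := h s
    rw [show thetaExp 1 0 (triangularCosets t s) = c + thetaExp i j s by omega, pow_add]
    simp only [one_pow, map_one, one_mul]
  have h0 := key 0 0 10 15 (by norm_num) fun s => by
    simp only [triangularCosets, two_mul_thetaExp]; push_cast; ring
  have h1 := key 1 1 5 20 (by norm_num) fun s => by
    simp only [triangularCosets, two_mul_thetaExp]; push_cast; ring
  have h2 := key 2 3 25 0 (by norm_num) fun s => by
    simp only [triangularCosets, two_mul_thetaExp]; push_cast; ring
  have h3 := key 3 1 5 20 (by norm_num) fun s => by
    simp only [triangularCosets, two_mul_thetaExp]; push_cast; ring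
  have h4 := key 4 0 10 15 (by norm_num) fun s => by
    simp only [triangularCosets, two_mul_thetaExp]; push_cast; ring
  have hsum := thetaSeries_one_one_zero
  rw [thetaSeries, tsum_eq_sum_tsum_of_bijective hs triangularCosets_bijective,
    Fin.sum_univ_five, h0, h1, h2, h3, h4, h25] at hsum
  rw [expandFive_thetaSeries _ (by norm_num), expandFive_thetaSeries _ (by norm_num)]
  norm_num only
  refine mul_left_cancel₀ (ofNat_ne_zero_int 2) ?_
  linear_combination -hsum

end Dissection

/-! ### The product of ψ(ζq) over the fifth roots of unity -/

section Norm

variable {ζ : ℂ}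

theorem rescale_expand_of_pow_eq_one {a : ℂ} {p : ℕ} (hp : p ≠ 0) (ha : a ^ p = 1) (f : ℂ⟦X⟧) :
    rescale a (expand p hp f) = expand p hp f := by
  ext n
  rw [coeff_rescale, coeff_expand]
  split_ifs with h
  · obtain ⟨k, rfl⟩ := h
    rw [pow_mul, ha, one_pow, one_mul]
  · rw [mul_zero]

/-- Pairing i with 5 - i leaves two factors with coefficients t = z + z^4 and t' = z^2 + z^3, for
which t + t' = tt' = -1. The weights 3, 0, 1 are the residues in the dissection of ψ. -/
theorem prod_add_zeta_mul_add_zeta_pow_mul {A : Type*} [CommRing A] {z : A}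
    (hz : 1 + z + z ^ 2 + z ^ 3 + z ^ 4 = 0) (c d e : A) :
    ∏ i ∈ Finset.range 5, (z ^ (3 * i) * e + c + z ^ i * d)
      = e ^ 5 + c ^ 5 + d ^ 5 - 5 * e ^ 3 * (c * d) + 5 * e * (c * d) ^ 2 := by
  have h5 : z ^ 5 = 1 := by linear_combination (z - 1) * hz
  have e6 : z ^ 6 = z := by linear_combination z * h5
  have e9 : z ^ 9 = z ^ 4 := by linear_combination z ^ 4 * h5
  have e12 : z ^ 12 = z ^ 2 := by linear_combination (z ^ 7 + z ^ 2) * h5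
  set t := z + z ^ 4 with ht
  set t' := z ^ 2 + z ^ 3 with ht'
  have hadd : t + t' = -1 := by rw [ht, ht']; linear_combination hz
  have hmul : t * t' = -1 := by rw [ht, ht']; linear_combination hz + (z + z ^ 2) * h5
  have q1 : (z ^ 3 * e + c + z * d) * (z ^ 2 * e + c + z ^ 4 * d)
      = e ^ 2 + c ^ 2 + d ^ 2 + t * (c * d) + t' * (c * e + d * e) := by
    rw [ht, ht']
    linear_combination (e ^ 2 + d ^ 2 + z ^ 2 * d * e) * h5
  have q2 : (z * e + c + z ^ 2 * d) * (z ^ 4 * e + c + z ^ 3 * d)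
      = e ^ 2 + c ^ 2 + d ^ 2 + t' * (c * d) + t * (c * e + d * e) := by
    rw [ht, ht']
    linear_combination (e ^ 2 + d ^ 2 + z * d * e) * h5
  have : ∏ i ∈ Finset.range 5, (z ^ (3 * i) * e + c + z ^ i * d)
      = (e + c + d) * ((z ^ 3 * e + c + z * d) * (z ^ 2 * e + c + z ^ 4 * d))
        * ((z * e + c + z ^ 2 * d) * (z ^ 4 * e + c + z ^ 3 * d)) := by
    simp only [Finset.prod_range_succ, Finset.prod_range_zero]
    norm_num [e6, e9, e12]
    ring
  rw [this, q1, q2]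
  linear_combination (e + c + d) * ((e ^ 2 + c ^ 2 + d ^ 2) * (c * d + (c * e + d * e))
      + (c * d) * (c * e + d * e) * (t + t' - 1)) * hadd
    + (e + c + d) * ((c * d) ^ 2 + (c * e + d * e) ^ 2 - 2 * ((c * d) * (c * e + d * e))) * hmul

/-- If 5 divides k, all five factors coincide; otherwise ζ^k is again primitive and the norm form
applies with e = 0, c = 1, d = -X^k. -/
theorem prod_range_five_one_sub_zeta_pow (hζ : IsPrimitiveRoot ζ 5) (k : ℕ) :
    ∏ i ∈ Finset.range 5, (1 - (C (ζ ^ i) * X) ^ k : ℂ⟦X⟧)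
      = if 5 ∣ k then (1 - X ^ k) ^ 5 else 1 - X ^ (5 * k) := by
  split_ifs with h
  · obtain ⟨l, rfl⟩ := h
    rw [← Finset.card_range 5, ← Finset.prod_const, Finset.card_range]
    refine Finset.prod_congr rfl fun i _ => ?_
    rw [mul_pow, ← map_pow, ← pow_mul, show i * (5 * l) = 5 * (i * l) by ring, pow_mul,
      hζ.pow_eq_one, one_pow, map_one, one_mul]
  · have hk : IsPrimitiveRoot (ζ ^ k) 5 :=
      hζ.pow_of_coprime k ((Nat.Prime.coprime_iff_not_dvd Nat.prime_five).2 h).symm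
    have hz : 1 + ζ ^ k + (ζ ^ k) ^ 2 + (ζ ^ k) ^ 3 + (ζ ^ k) ^ 4 = 0 := by
      simpa [Finset.sum_range_succ] using hk.geom_sum_eq_zero (by norm_num)
    have hz' : 1 + (C (ζ ^ k) : ℂ⟦X⟧) + C (ζ ^ k) ^ 2 + C (ζ ^ k) ^ 3 + C (ζ ^ k) ^ 4 = 0 := by
      simpa using congrArg (C : ℂ →+* ℂ⟦X⟧) hz
    have := prod_add_zeta_mul_add_zeta_pow_mul hz' 1 (-X ^ k) 0
    have e : ∀ i, (1 - (C (ζ ^ i) * X) ^ k : ℂ⟦X⟧)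
        = C (ζ ^ k) ^ (3 * i) * 0 + 1 + C (ζ ^ k) ^ i * -X ^ k := by
      intro i
      rw [mul_pow, ← map_pow, ← map_pow C (ζ ^ k) i, ← pow_mul, ← pow_mul, mul_comm i k]
      ring
    simp only [e, this]
    rw [mul_comm 5 k, pow_mul]
    ring

/-- The Euler function at `X ^ m`, with complex coefficients. -/
noncomputable def complexEulerF (m : ℕ) : ℂ⟦X⟧ := eulerProd ℂ fun n => if m ∣ n then 1 else 0

theorem map_eulerF (m : ℕ) : map (Int.castRingHom ℂ) (eulerF m) = complexEulerF m :=
  map_eulerProd continuous_of_discreteTopology _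

/-- Indices n prime to 5 give 1 - X^(5mn), and multiples of 5 give fifth powers. Regrouped, these
are F_(5m) / F_(25m) and F_(5m)^5. -/
theorem prod_rescale_complexEulerF (hζ : IsPrimitiveRoot ζ 5) {m : ℕ} (hm : ¬ 5 ∣ m) :
    (∏ i ∈ Finset.range 5, rescale (ζ ^ i) (complexEulerF m)) * complexEulerF (25 * m)
      = complexEulerF (5 * m) ^ 6 := by
  have hm0 : 0 < m := Nat.pos_of_ne_zero (by rintro rfl; simp at hm)
  have hdvd : ∀ n, 5 ∣ m * n ↔ 5 ∣ n := fun n =>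
    ⟨fun h => (Nat.prime_five.dvd_mul.1 h).resolve_left hm, fun h => h.mul_left m⟩
  have hlem : ∀ n, n ≤ m * (n + 1) := fun n => by nlinarith
  have hle5 : ∀ n, n ≤ 5 * m * (n + 1) := fun n => by nlinarith
  have h1 : complexEulerF m = ∏' n : ℕ, (1 - X ^ (m * (n + 1)) : ℂ⟦X⟧) := by
    have := tprod_one_sub_X_pow_arith (R := ℂ) hm0 le_rfl
    simp only [Nat.mod_self, ← Nat.dvd_iff_mod_eq_zero] at this
    rw [complexEulerF, ← this]
    rfl
  have hmult : ∀ i, Multipliable fun n : ℕ => (1 - (C (ζ ^ i) * X) ^ (m * (n + 1)) : ℂ⟦X⟧) := by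
    intro i
    refine multipliable_of_X_pow_dvd fun n => ?_
    rw [sub_sub_cancel_left, dvd_neg, mul_pow]
    exact (pow_dvd_pow X (hlem n)).mul_left _
  have h2 : ∀ i, rescale (ζ ^ i) (complexEulerF m)
      = ∏' n : ℕ, (1 - (C (ζ ^ i) * X) ^ (m * (n + 1)) : ℂ⟦X⟧) := by
    intro i
    have : Multipliable fun n : ℕ => (1 - X ^ (m * (n + 1)) : ℂ⟦X⟧) := by
      simpa using multipliable_one_sub_X_pow_pow (R := ℂ) hlem fun _ => 1
    rw [h1, this.map_tprod _ (continuous_rescale _)]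
    simp [rescale_X]
  have h3 : ∏ i ∈ Finset.range 5, rescale (ζ ^ i) (complexEulerF m)
      = (∏' n : ℕ, (1 - X ^ (m * (n + 1)) : ℂ⟦X⟧) ^ (if 5 ∣ n + 1 then 5 else 0))
        * ∏' n : ℕ, (1 - X ^ (5 * m * (n + 1)) : ℂ⟦X⟧) ^ (if 5 ∣ n + 1 then 0 else 1) := by
    simp only [h2]
    rw [← Multipliable.tprod_finsetProd fun i _ => hmult i,
      ← Multipliable.tprod_mul (multipliable_one_sub_X_pow_pow hlem _)
        (multipliable_one_sub_X_pow_pow hle5 _)]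
    refine tprod_congr fun n => ?_
    rw [prod_range_five_one_sub_zeta_pow hζ]
    simp only [hdvd]
    split_ifs
    · simp
    · simp [mul_assoc]
  have h4 : ∏' n : ℕ, (1 - X ^ (m * (n + 1)) : ℂ⟦X⟧) ^ (if 5 ∣ n + 1 then 5 else 0)
      = eulerProd ℂ fun N => if 5 * m ∣ N then 5 else 0 := by
    refine tprod_one_sub_X_pow_comp (g := fun n => m * (n + 1)) ?_ (fun n => by positivity) _ _
      (fun n => ?_) ?_
    · intro a b h
      have := Nat.eq_of_mul_eq_mul_left hm0 h
      omega
    · simp only [mul_comm 5 m, Nat.mul_dvd_mul_iff_left hm0]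
    · intro N hN h
      simp only [ne_eq, ite_eq_right_iff, Classical.not_imp] at h
      obtain ⟨k, rfl⟩ := (Dvd.intro_left 5 rfl : m ∣ 5 * m).trans h.1
      have hk : k ≠ 0 := by rintro rfl; simp at hN
      exact ⟨k - 1, congrArg (m * ·) (Nat.sub_add_cancel (Nat.one_le_iff_ne_zero.2 hk))⟩
  have h5 : ∏' n : ℕ, (1 - X ^ (5 * m * (n + 1)) : ℂ⟦X⟧) ^ (if 5 ∣ n + 1 then 0 else 1)
      = eulerProd ℂ fun N => if 5 * m ∣ N ∧ ¬ 25 * m ∣ N then 1 else 0 := by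
    have hd : ∀ k, 25 * m ∣ 5 * m * k ↔ 5 ∣ k := fun k => by
      rw [show 25 * m = 5 * m * 5 by ring, Nat.mul_dvd_mul_iff_left (by positivity)]
    refine tprod_one_sub_X_pow_comp (g := fun n => 5 * m * (n + 1)) ?_ (fun n => by positivity) _ _
      (fun n => ?_) ?_
    · intro a b h
      have := Nat.eq_of_mul_eq_mul_left (by positivity : 0 < 5 * m) h
      omega
    · simp only [hd, dvd_mul_right, true_and]
      split_ifs <;> rfl
    · intro N hN h
      simp only [ne_eq, ite_eq_right_iff, Classical.not_imp] at h
      obtain ⟨k, rfl⟩ := h.1.1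
      have hk : k ≠ 0 := by rintro rfl; simp at hN
      exact ⟨k - 1, congrArg (5 * m * ·) (Nat.sub_add_cancel (Nat.one_le_iff_ne_zero.2 hk))⟩
  rw [h3, h4, h5, complexEulerF, complexEulerF, ← eulerProd_nsmul, ← eulerProd_add,
    ← eulerProd_add]
  refine eulerProd_congr fun n => ?_
  simp only [Pi.add_apply, Pi.smul_apply]
  have : 25 * m ∣ n + 1 → 5 * m ∣ n + 1 := (Dvd.intro_left 5 (by ring)).trans
  split_ifs <;> simp_all

/-- The norm of ψ is computed twice: from the dissection, as a form in its three components, and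
from ψ = F_2^2 / F_1, as ψ(q^5)^6 / ψ(q^25). The roots of unity live in ℂ, and the identity descends
because ℤ embeds in ℂ. -/
theorem psi_norm :
    ((X ^ 3 * expandFive (expandFive psi)) ^ 5 + expandFive (thetaSeries 1 2 3) ^ 5
      + (X * expandFive (thetaSeries 1 1 4)) ^ 5
      - 5 * (X ^ 3 * expandFive (expandFive psi)) ^ 3
        * (expandFive (thetaSeries 1 2 3) * (X * expandFive (thetaSeries 1 1 4)))
      + 5 * (X ^ 3 * expandFive (expandFive psi))
        * (expandFive (thetaSeries 1 2 3) * (X * expandFive (thetaSeries 1 1 4))) ^ 2)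
      * expandFive (expandFive psi) = expandFive psi ^ 6 := by
  have hζ := Complex.isPrimitiveRoot_exp 5 (by norm_num)
  set ζ := Complex.exp (2 * Real.pi * Complex.I / (5 : ℕ))
  have hinj : Function.Injective (map (Int.castRingHom ℂ)) :=
    PowerSeries.map_injective _ Int.cast_injective
  have hz : 1 + ζ + ζ ^ 2 + ζ ^ 3 + ζ ^ 4 = 0 := by
    simpa [Finset.sum_range_succ] using hζ.geom_sum_eq_zero (by norm_num)
  have hz' : 1 + (C ζ : ℂ⟦X⟧) + C ζ ^ 2 + C ζ ^ 3 + C ζ ^ 4 = 0 := by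
    simpa using congrArg (C : ℂ →+* ℂ⟦X⟧) hz
  have hfix : ∀ (i : ℕ) (f : ℤ⟦X⟧), rescale (ζ ^ i) (map (Int.castRingHom ℂ) (expandFive f))
      = map (Int.castRingHom ℂ) (expandFive f) := by
    intro i f
    rw [expandFive, map_expand]
    refine rescale_expand_of_pow_eq_one _ ?_ _
    rw [← pow_mul, mul_comm, pow_mul, hζ.pow_eq_one, one_pow]
  have hconj : ∀ i, rescale (ζ ^ i) (map (Int.castRingHom ℂ) psi)
      = C ζ ^ (3 * i) * map (Int.castRingHom ℂ) (X ^ 3 * expandFive (expandFive psi))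
        + map (Int.castRingHom ℂ) (expandFive (thetaSeries 1 2 3))
        + C ζ ^ i * map (Int.castRingHom ℂ) (X * expandFive (thetaSeries 1 1 4)) := by
    intro i
    conv_lhs => rw [psi_dissection]
    simp only [map_add, map_mul, map_pow, hfix, map_X, rescale_X]
    ring
  have hprod := prod_add_zeta_mul_add_zeta_pow_mul hz'
    (map (Int.castRingHom ℂ) (expandFive (thetaSeries 1 2 3)))
    (map (Int.castRingHom ℂ) (X * expandFive (thetaSeries 1 1 4)))
    (map (Int.castRingHom ℂ) (X ^ 3 * expandFive (expandFive psi)))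
  simp only [← hconj] at hprod
  have hN : (∏ i ∈ Finset.range 5, rescale (ζ ^ i) (map (Int.castRingHom ℂ) psi))
      * map (Int.castRingHom ℂ) (expandFive (expandFive psi))
      = map (Int.castRingHom ℂ) (expandFive psi) ^ 6 := by
    have n1 := prod_rescale_complexEulerF hζ (m := 1) (by norm_num)
    have n2 := prod_rescale_complexEulerF hζ (m := 2) (by norm_num)
    have p1 : (∏ i ∈ Finset.range 5, rescale (ζ ^ i) (map (Int.castRingHom ℂ) psi))
        * (∏ i ∈ Finset.range 5, rescale (ζ ^ i) (complexEulerF 1))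
        = (∏ i ∈ Finset.range 5, rescale (ζ ^ i) (complexEulerF 2)) ^ 2 := by
      rw [← Finset.prod_mul_distrib, ← Finset.prod_pow]
      refine Finset.prod_congr rfl fun i _ => ?_
      rw [← map_eulerF, ← map_eulerF, ← map_mul, ← map_mul, psi_mul_eulerF, map_pow, map_pow]
    have p5 : map (Int.castRingHom ℂ) (expandFive psi) * complexEulerF 5
        = complexEulerF 10 ^ 2 := by
      rw [← map_eulerF, ← map_eulerF, ← map_mul, expandFive_psi_mul_eulerF, map_pow]
    have p25 : map (Int.castRingHom ℂ) (expandFive (expandFive psi)) * complexEulerF 25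
        = complexEulerF 50 ^ 2 := by
      have := congrArg expandFive expandFive_psi_mul_eulerF
      rw [map_mul, map_pow, expandFive_eulerF, expandFive_eulerF] at this
      rw [← map_eulerF, ← map_eulerF, ← map_mul, this, map_pow]
    norm_num only at n1 n2
    have hne : complexEulerF 5 ^ 6 ≠ 0 := pow_ne_zero _ (isUnit_eulerProd _).ne_zero
    refine mul_right_cancel₀ hne ?_
    generalize (∏ i ∈ Finset.range 5, rescale (ζ ^ i) (complexEulerF 1)) = N1 at *
    generalize (∏ i ∈ Finset.range 5, rescale (ζ ^ i) (complexEulerF 2)) = N2 at *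
    generalize (∏ i ∈ Finset.range 5, rescale (ζ ^ i) (map (Int.castRingHom ℂ) psi)) = N at *
    generalize map (Int.castRingHom ℂ) (expandFive (expandFive psi)) = g25 at *
    generalize map (Int.castRingHom ℂ) (expandFive psi) = g5 at *
    rw [← mul_pow, p5, ← n1]
    calc N * g25 * (N1 * complexEulerF 25) = (N * N1) * (g25 * complexEulerF 25) := by ring
      _ = (N2 * complexEulerF 50) ^ 2 := by rw [p1, p25]; ring
      _ = (complexEulerF 10 ^ 2) ^ 6 := by rw [n2]; ring
  rw [hprod] at hN
  refine hinj ?_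
  simp only [map_add, map_sub, map_mul, map_pow, map_ofNat] at hN ⊢
  exact hN

end Norm

/-! ### The Atkin operator and the Hauptmodul of level 10 -/

section AtkinOperator

/-- The Atkin operator, extracting the coefficients with index divisible by `5`. -/
noncomputable def atkinFive : ℤ⟦X⟧ →ₗ[ℤ] ℤ⟦X⟧ where
  toFun f := mk fun n => coeff (5 * n) f
  map_add' f g := by ext n; simp
  map_smul' c f := by
    ext n
    rw [RingHom.id_apply, coeff_mk, map_smul, map_smul, coeff_mk]

theorem coeff_atkinFive (f : ℤ⟦X⟧) (n : ℕ) : coeff n (atkinFive f) = coeff (5 * n) f := by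
  simp [atkinFive]

/-- Only the indices divisible by 5 of the first factor contribute, so series in X^5 pass through
the operator. -/
theorem atkinFive_expandFive_mul (f g : ℤ⟦X⟧) :
    atkinFive (expandFive f * g) = f * atkinFive g := by
  ext n
  rw [coeff_atkinFive, coeff_mul, coeff_mul]
  symm
  refine Finset.sum_of_injOn (fun p => (5 * p.1, 5 * p.2)) ?_ ?_ ?_ ?_
  · intro p _ q _ h
    simp only [Prod.mk.injEq] at h
    ext <;> omega
  · intro p hp
    have := Finset.HasAntidiagonal.mem_antidiagonal.1 (Finset.mem_coe.1 hp)
    exact Finset.mem_coe.2 <| Finset.HasAntidiagonal.mem_antidiagonal.2 (by simp only; omega)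
  · rintro ⟨i, j⟩ hp hn
    have hp := Finset.HasAntidiagonal.mem_antidiagonal.1 hp
    simp only at hp
    have : ¬ 5 ∣ i := by
      rintro ⟨k, rfl⟩
      refine hn ⟨(k, n - k), Finset.mem_coe.2 (Finset.HasAntidiagonal.mem_antidiagonal.2 ?_), ?_⟩
      · simp only; omega
      · simp only [Prod.mk.injEq, true_and]; omega
    simp only
    rw [expandFive, coeff_expand_of_not_dvd _ _ _ this, zero_mul]
  · intro p _
    simp only
    rw [coeff_atkinFive, expandFive, coeff_expand_mul]

theorem atkinFive_expandFive (f : ℤ⟦X⟧) : atkinFive (expandFive f) = f := by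
  ext n
  rw [coeff_atkinFive, expandFive, coeff_expand_mul]

theorem atkinFive_X_pow_mul_expandFive {k : ℕ} (hk : ¬ 5 ∣ k) (f : ℤ⟦X⟧) :
    atkinFive (X ^ k * expandFive f) = 0 := by
  ext n
  rw [coeff_atkinFive, coeff_X_pow_mul', map_zero]
  split_ifs with h
  · exact coeff_expand_of_not_dvd _ _ _ fun h' => hk (by omega)
  · rfl

theorem atkinFive_eq {f h₀ h₁ h₂ h₃ h₄ : ℤ⟦X⟧}
    (h : f = expandFive h₀ + X ^ 1 * expandFive h₁ + X ^ 2 * expandFive h₂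
      + X ^ 3 * expandFive h₃ + X ^ 4 * expandFive h₄) : atkinFive f = h₀ := by
  rw [h]
  simp only [map_add atkinFive]
  rw [atkinFive_expandFive, atkinFive_X_pow_mul_expandFive (by norm_num),
    atkinFive_X_pow_mul_expandFive (by norm_num), atkinFive_X_pow_mul_expandFive (by norm_num),
    atkinFive_X_pow_mul_expandFive (by norm_num)]
  simp

theorem expandFive_X : expandFive X = X ^ 5 := expand_X _ _

/-- The inverse of `psi`. -/
noncomputable def psiInv : ℤ⟦X⟧ := eulerF 1 * eulerFInv 2 ^ 2

theorem psi_mul_psiInv : psi * psiInv = 1 := by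
  rw [psi, psiInv]
  linear_combination (eulerF 2 * eulerFInv 2 + 1) * eulerF_mul_inv 2
    + eulerF 2 ^ 2 * eulerFInv 2 ^ 2 * eulerF_mul_inv 1

theorem expandFive_psi_mul : expandFive psi * expandFive psiInv = 1 := by
  rw [← map_mul, psi_mul_psiInv, map_one]

/-- The modular function `q ψ(q⁵)² / ψ(q)²` of level 10. -/
noncomputable def hauptmodul : ℤ⟦X⟧ := X * expandFive psi ^ 2 * psiInv ^ 2

theorem hauptmodul_mul_psi_sq : hauptmodul * psi ^ 2 = X * expandFive psi ^ 2 := by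
  rw [hauptmodul]
  linear_combination (X * expandFive psi ^ 2 * (psi * psiInv + 1)) * psi_mul_psiInv

theorem psi_ne_zero : psi ≠ 0 := left_ne_zero_of_mul (psi_mul_psiInv.trans_ne one_ne_zero)

theorem expandFive_psi_ne_zero : expandFive psi ≠ 0 :=
  left_ne_zero_of_mul (expandFive_psi_mul.trans_ne one_ne_zero)

theorem expandFive_expandFive_psi_ne_zero : expandFive (expandFive psi) ≠ 0 := by
  have h : expandFive (expandFive psi) * expandFive (expandFive psiInv) = 1 := by
    rw [← map_mul, expandFive_psi_mul, map_one]
  exact left_ne_zero_of_mul (h.trans_ne one_ne_zero)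

theorem hauptmodul_ne_zero : hauptmodul ≠ 0 := by
  refine left_ne_zero_of_mul (hauptmodul_mul_psi_sq.trans_ne ?_)
  exact mul_ne_zero X_ne_zero (pow_ne_zero _ expandFive_psi_ne_zero)

/-- This and the next two relations express eta quotients of level 10 through s. Here 1 - s comes
from ψ(q)^2 - q ψ(q^5)^2; below, 1 - 5s comes from the analogous identity for thetaSeries (-1) 1 1.
-/
theorem eulerF_one_mul_five_cube :
    eulerF 1 * eulerF 5 ^ 3 = (1 - hauptmodul) * eulerF 2 ^ 3 * eulerF 10 := by
  refine mul_right_cancel₀ (eulerF_ne_zero 2) ?_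
  linear_combination -eulerF 1 * psi_sq_sub_mul
    + eulerF 1 ^ 2 * eulerF 10 * hauptmodul_mul_psi_sq
    + eulerF 10 * (1 - hauptmodul) * (psi * eulerF 1 + eulerF 2 ^ 2) * psi_mul_eulerF

theorem hauptmodul_mul_eulerF :
    hauptmodul * (eulerF 2 ^ 4 * eulerF 5 ^ 2) = X * eulerF 10 ^ 4 * eulerF 1 ^ 2 := by
  linear_combination (eulerF 1 ^ 2 * eulerF 5 ^ 2) * hauptmodul_mul_psi_sq
    - hauptmodul * eulerF 5 ^ 2 * (psi * eulerF 1 + eulerF 2 ^ 2) * psi_mul_eulerF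
    + X * eulerF 1 ^ 2 * (expandFive psi * eulerF 5 + eulerF 10 ^ 2) * expandFive_psi_mul_eulerF

theorem eulerF_one_pow_five_mul_ten :
    eulerF 1 ^ 5 * eulerF 10 = (1 - 5 * hauptmodul) * eulerF 2 ^ 5 * eulerF 5 := by
  have h1 := thetaSeries_neg_one_one_one_sq
  have h2 := thetaSeries_neg_one_one_one_mul
  have h3 := congrArg expandFive h2
  rw [map_mul, map_pow, expandFive_thetaSeries _ (by norm_num), expandFive_eulerF,
    expandFive_eulerF] at h3
  norm_num only at h3
  have h4 := thetaSeries_neg_one_one_nine_mul_three_seven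
  have h5 := eulerF_one_mul_five_cube
  have h6 := hauptmodul_mul_eulerF
  refine mul_right_cancel₀ (mul_ne_zero (eulerF_ne_zero 5) (eulerF_ne_zero 10)) ?_
  generalize thetaSeries (-1) 1 1 = p at *
  generalize thetaSeries (-1) 5 5 = p5 at *
  generalize thetaSeries (-1) 1 9 = q at *
  generalize thetaSeries (-1) 3 7 = q' at *
  linear_combination (eulerF 1 * eulerF 2 ^ 2 * eulerF 5 * eulerF 10 ^ 2) * h1
    - eulerF 1 * eulerF 5 * eulerF 10 ^ 2 * (p * eulerF 2 + eulerF 1 ^ 2) * h2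
    + eulerF 1 * eulerF 2 ^ 2 * eulerF 5 * (p5 * eulerF 10 + eulerF 5 ^ 2) * h3
    - 4 * X * eulerF 1 * eulerF 2 * eulerF 10 ^ 2 * h4
    + eulerF 2 ^ 2 * eulerF 5 ^ 2 * h5 - 4 * eulerF 2 * eulerF 10 * (-h6)

end AtkinOperator

/-! ### The modular equation of degree 5 and the traces of powers of ρ -/

section ModularEquation

/-- The ratio `q³ ψ(q²⁵) / ψ(q)`, a square root of the product of `hauptmodul` and its
substitution. -/
noncomputable def psiRatio : ℤ⟦X⟧ := X ^ 3 * expandFive (expandFive psi) * psiInv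

theorem psiRatio_mul_psi : psiRatio * psi = X ^ 3 * expandFive (expandFive psi) := by
  rw [psiRatio, mul_assoc, mul_comm psiInv, psi_mul_psiInv, mul_one]

theorem expandFive_hauptmodul_mul :
    expandFive hauptmodul * expandFive psi ^ 2 = X ^ 5 * expandFive (expandFive psi) ^ 2 := by
  simpa [expandFive_X] using congrArg expandFive hauptmodul_mul_psi_sq

theorem psiRatio_sq : psiRatio ^ 2 = hauptmodul * expandFive hauptmodul := by
  refine mul_right_cancel₀ (mul_ne_zero (pow_ne_zero 2 psi_ne_zero)
    (pow_ne_zero 2 expandFive_psi_ne_zero)) ?_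
  linear_combination (expandFive psi ^ 2 * (psiRatio * psi
      + X ^ 3 * expandFive (expandFive psi))) * psiRatio_mul_psi
    - expandFive hauptmodul * expandFive psi ^ 2 * hauptmodul_mul_psi_sq
    - X * expandFive psi ^ 2 * expandFive_hauptmodul_mul

/-- Write ψ = e + c + d for the dissection and σ = s(q^5). The identity for ψ^2 at q^5 gives cd =
e^2 (1 - σ)/σ, and c + d = ψ - e, so c^5 + d^5 is a polynomial in ψ, e and cd. The norm of ψ equals
e^5/σ^3. Eliminating c and d leaves a quintic relation between e and ψ, homogeneous over polynomials
in σ; then put e = ρψ. -/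
theorem psiRatio_pow_five :
    psiRatio ^ 5 = expandFive (5 * hauptmodul * (1 - 5 * hauptmodul + 5 * hauptmodul ^ 2))
        * psiRatio ^ 4
      + expandFive (5 * hauptmodul ^ 2 * (3 - 5 * hauptmodul)) * psiRatio ^ 3
      + expandFive (5 * hauptmodul ^ 2 * (3 * hauptmodul - 1)) * psiRatio ^ 2
      + expandFive (-5 * hauptmodul ^ 3) * psiRatio + expandFive (hauptmodul ^ 3) := by
  have hd := psi_dissection
  have hn := psi_norm
  have hr := psiRatio_mul_psi
  have hs := expandFive_hauptmodul_mul
  have hcd : expandFive (thetaSeries 1 2 3) * (X * expandFive (thetaSeries 1 1 4))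
      = X * (expandFive psi ^ 2 - X ^ 5 * expandFive (expandFive psi) ^ 2) := by
    have := congrArg expandFive psi_sq
    simp only [map_add, map_mul, map_pow, expandFive_X] at this
    linear_combination -X * this
  simp only [map_mul, map_sub, map_add, map_neg, map_one, map_pow, map_ofNat]
  refine mul_right_cancel₀ (pow_ne_zero 5 psi_ne_zero) ?_
  generalize expandFive hauptmodul = σ at *
  generalize hP : expandFive (expandFive psi) = P at *
  have hP0 : P ≠ 0 := hP ▸ expandFive_expandFive_psi_ne_zero
  generalize expandFive psi = P₅ at *
  generalize expandFive (thetaSeries 1 2 3) = c at *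
  generalize X * expandFive (thetaSeries 1 1 4) = d at *
  generalize psiRatio = ρ at *
  obtain ⟨e, he⟩ : ∃ e, e = X ^ 3 * P := ⟨_, rfl⟩
  rw [← he] at hd hn hr
  have hcde : c * d * σ = e ^ 2 * (1 - σ) := by
    rw [hcd, he]
    linear_combination X * hs
  have he5 : e ^ 5 * P = σ ^ 3 * P₅ ^ 6 := by
    rw [he]
    linear_combination -(σ ^ 2 * P₅ ^ 4 + σ * P₅ ^ 2 * (X ^ 5 * P ^ 2) + (X ^ 5 * P ^ 2) ^ 2) * hs
  have hbr : σ ^ 3 * (e ^ 5 + c ^ 5 + d ^ 5 - 5 * e ^ 3 * (c * d) + 5 * e * (c * d) ^ 2)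
      = e ^ 5 := by
    refine mul_right_cancel₀ hP0 ?_
    linear_combination σ ^ 3 * hn - he5
  have hG : c ^ 5 + d ^ 5 = (psi - e) ^ 5 - 5 * (c * d) * (psi - e) ^ 3
      + 5 * (c * d) ^ 2 * (psi - e) := by
    rw [hd]
    ring
  have key : e ^ 5 = 5 * σ * (1 - 5 * σ + 5 * σ ^ 2) * e ^ 4 * psi
      + 5 * σ ^ 2 * (3 - 5 * σ) * e ^ 3 * psi ^ 2 + 5 * σ ^ 2 * (3 * σ - 1) * e ^ 2 * psi ^ 3
      + -5 * σ ^ 3 * e * psi ^ 4 + σ ^ 3 * psi ^ 5 := by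
    generalize psi = x at *
    linear_combination -hbr + σ ^ 3 * hG
      + (-5 * σ ^ 2 * (x - e) ^ 3 - 5 * σ ^ 2 * e ^ 3
        + 5 * σ * x * (c * d * σ + e ^ 2 * (1 - σ))) * hcde
  generalize psi = x at *
  rw [← hr] at key
  linear_combination key

/-- The images under the Atkin operator of `e ψ(q)⁴ ρ ^ j`, where `e = q³ ψ(q²⁵)` and `ρ` is
`psiRatio`. -/
noncomputable def psiTrace (j : ℕ) : ℤ⟦X⟧ :=
  atkinFive (X ^ 3 * expandFive (expandFive psi) * psi ^ 4 * psiRatio ^ j)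

/-- The coefficients of the quintic are series in X^5, so they pass through the Atkin operator with
s(q^5) replaced by s(q). -/
theorem psiTrace_add_five (j : ℕ) :
    psiTrace (j + 5) = 5 * hauptmodul * (1 - 5 * hauptmodul + 5 * hauptmodul ^ 2)
        * psiTrace (j + 4)
      + 5 * hauptmodul ^ 2 * (3 - 5 * hauptmodul) * psiTrace (j + 3)
      + 5 * hauptmodul ^ 2 * (3 * hauptmodul - 1) * psiTrace (j + 2)
      + -5 * hauptmodul ^ 3 * psiTrace (j + 1) + hauptmodul ^ 3 * psiTrace j := by
  simp only [psiTrace, ← atkinFive_expandFive_mul, ← map_add atkinFive]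
  congr 1
  simp only [pow_add psiRatio j]
  rw [psiRatio_pow_five]
  ring

/-- The factor eψ^4 is chosen for this: eψ^4 ρ^4 = e^5 is a series in X^5, while for j ≤ 4 the
product eψ^4 ρ^j is a polynomial in e and ψ, so the starting values come from the dissection alone.
-/
theorem psiTrace_add_four (j : ℕ) :
    psiTrace (j + 4) = X ^ 3 * expandFive psi ^ 5 * atkinFive (psiRatio ^ j) := by
  rw [psiTrace, ← atkinFive_expandFive_mul]
  congr 1
  simp only [map_mul, map_pow, expandFive_X]
  rw [pow_add]
  have h : psi ^ 4 * psiRatio ^ 4 = (X ^ 3 * expandFive (expandFive psi)) ^ 4 := by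
    rw [← psiRatio_mul_psi]
    ring
  linear_combination (X ^ 3 * expandFive (expandFive psi) * psiRatio ^ j) * h

theorem hauptmodul_mul_theta :
    hauptmodul * (thetaSeries 1 2 3 * thetaSeries 1 1 4)
      = X * expandFive psi ^ 2 * (1 - hauptmodul) := by
  linear_combination -hauptmodul * psi_sq + hauptmodul_mul_psi_sq

theorem psiTrace_eq (j : ℕ) (hj : j ≤ 4) : psiTrace j
    = atkinFive ((X ^ 3 * expandFive (expandFive psi)) ^ (j + 1) * psi ^ (4 - j)) := by
  have hsplit : psi ^ 4 = psi ^ (4 - j) * psi ^ j := by rw [← pow_add, Nat.sub_add_cancel hj]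
  rw [psiTrace, ← psiRatio_mul_psi, hsplit]
  congr 1
  rw [pow_succ (psiRatio * psi), mul_pow psiRatio psi j]
  ring

theorem psiTrace_three : psiTrace 3 = X ^ 3 * expandFive psi ^ 5 := by
  rw [psiTrace_eq 3 (by norm_num)]
  have hd := psi_dissection
  generalize expandFive psi = a at *
  generalize thetaSeries 1 2 3 = b at *
  generalize thetaSeries 1 1 4 = g at *
  -- The h's are the components, by exponent modulo 5, of the expansion obtained from the dissection
  -- of ψ; here and in the next three lemmas only the zeroth survives.
  refine atkinFive_eq (h₁ := 0) (h₂ := X ^ 2 * a ^ 4 * b) (h₃ := X ^ 2 * a ^ 4 * g) (h₄ := 0) ?_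
  simp only [hd, map_mul, map_pow, map_zero, expandFive_X]
  ring

/-- The trace involves the product of the two theta series, which is X ψ(q^5)^2 (1 - s)/s; the
factor s clears this denominator. `psiTrace_zero` needs s^2, since the product is squared there. -/
theorem psiTrace_two :
    hauptmodul * psiTrace 2 = X ^ 3 * expandFive psi ^ 5 * (2 - hauptmodul) := by
  rw [psiTrace_eq 2 (by norm_num)]
  have hd := psi_dissection
  have hm := hauptmodul_mul_theta
  generalize expandFive psi = a at *
  generalize thetaSeries 1 2 3 = b at *
  generalize thetaSeries 1 1 4 = g at *
  rw [atkinFive_eq (h₀ := X ^ 3 * a ^ 5 + 2 * X ^ 2 * a ^ 3 * (b * g))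
    (h₁ := X ^ 2 * a ^ 3 * g ^ 2) (h₂ := 2 * X ^ 2 * a ^ 4 * b) (h₃ := 2 * X ^ 2 * a ^ 4 * g)
    (h₄ := X * a ^ 3 * b ^ 2)]
  · linear_combination 2 * X ^ 2 * a ^ 3 * hm
  · simp only [hd, map_add, map_mul, map_pow, map_ofNat, expandFive_X]
    ring

theorem psiTrace_one :
    hauptmodul * psiTrace 1 = X ^ 3 * expandFive psi ^ 5 * (6 - 5 * hauptmodul) := by
  rw [psiTrace_eq 1 (by norm_num)]
  have hd := psi_dissection
  have hm := hauptmodul_mul_theta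
  generalize expandFive psi = a at *
  generalize thetaSeries 1 2 3 = b at *
  generalize thetaSeries 1 1 4 = g at *
  rw [atkinFive_eq (h₀ := X ^ 3 * a ^ 5 + 6 * X ^ 2 * a ^ 3 * (b * g))
    (h₁ := 3 * X ^ 2 * a ^ 3 * g ^ 2 + X * a ^ 2 * b ^ 3)
    (h₂ := 3 * X ^ 2 * a ^ 4 * b + 3 * X * a ^ 2 * b ^ 2 * g)
    (h₃ := 3 * X ^ 2 * a ^ 4 * g + 3 * X * a ^ 2 * b * g ^ 2)
    (h₄ := 3 * X * a ^ 3 * b ^ 2 + X * a ^ 2 * g ^ 3)]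
  · linear_combination 6 * X ^ 2 * a ^ 3 * hm
  · simp only [hd, map_add, map_mul, map_pow, map_ofNat, expandFive_X]
    ring

theorem psiTrace_zero :
    hauptmodul ^ 2 * psiTrace 0 = X ^ 3 * expandFive psi ^ 5
      * (hauptmodul ^ 2 + 12 * hauptmodul * (1 - hauptmodul) + 6 * (1 - hauptmodul) ^ 2) := by
  rw [psiTrace_eq 0 (by norm_num)]
  have hd := psi_dissection
  have hm := hauptmodul_mul_theta
  generalize expandFive psi = a at *
  generalize thetaSeries 1 2 3 = b at *
  generalize thetaSeries 1 1 4 = g at *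
  rw [atkinFive_eq (h₀ := X ^ 3 * a ^ 5 + 12 * X ^ 2 * a ^ 3 * (b * g) + 6 * X * a * (b * g) ^ 2)
    (h₁ := 6 * X ^ 2 * a ^ 3 * g ^ 2 + 4 * X * a ^ 2 * b ^ 3 + 4 * X * a * b * g ^ 3)
    (h₂ := 4 * X ^ 2 * a ^ 4 * b + 12 * X * a ^ 2 * b ^ 2 * g + X * a * g ^ 4)
    (h₃ := 4 * X ^ 2 * a ^ 4 * g + 12 * X * a ^ 2 * b * g ^ 2 + a * b ^ 4)
    (h₄ := 6 * X * a ^ 3 * b ^ 2 + 4 * X * a ^ 2 * g ^ 3 + 4 * a * b ^ 3 * g)]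
  · linear_combination (12 * X ^ 2 * a ^ 3 * hauptmodul + 6 * X * a * (hauptmodul * (b * g)
      + X * a ^ 2 * (1 - hauptmodul))) * hm
  · simp only [hd, map_add, map_mul, map_pow, map_ofNat, expandFive_X]
    ring

end ModularEquation

/-! ### Congruences modulo 25 for F_2 / F_1^3 -/

section Congruences

/-- Since ρ^2 = s(q) s(q^5), the trace of index 2k + 4 is κ s^k U(s^k) with κ = X^3 ψ(q^5)^5.
Running the recurrence up to index 10 gives U(s), U(s^2), U(s^3) as exact polynomials in s, which
are then reduced. -/
theorem atkinFive_hauptmodul_pow_congr :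
    (∃ g, atkinFive hauptmodul = 11 * hauptmodul + 15 * hauptmodul ^ 2 + 25 * g) ∧
    (∃ g, atkinFive (hauptmodul ^ 2) = hauptmodul + 25 * g) ∧
    ∃ g, atkinFive (hauptmodul ^ 3) = hauptmodul + 5 * g := by
  have t0 := psiTrace_zero
  have t1 := psiTrace_one
  have t2 := psiTrace_two
  have t3 := psiTrace_three
  have tk := psiTrace_add_four
  have h0 := hauptmodul_ne_zero
  have hκ : (X ^ 3 * expandFive psi ^ 5 : ℤ⟦X⟧) ≠ 0 :=
    mul_ne_zero (pow_ne_zero _ X_ne_zero) (pow_ne_zero _ expandFive_psi_ne_zero)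
  have t4 : psiTrace 4 = X ^ 3 * expandFive psi ^ 5 := by
    have h1 : atkinFive 1 = 1 := by simpa using atkinFive_expandFive 1
    rw [tk 0, pow_zero, h1, mul_one]
  have hpow : ∀ k, atkinFive (psiRatio ^ (2 * k))
      = hauptmodul ^ k * atkinFive (hauptmodul ^ k) := by
    intro k
    rw [pow_mul, psiRatio_sq, mul_pow, mul_comm, ← map_pow, atkinFive_expandFive_mul]
  have u1 := hpow 1
  have u2 := hpow 2
  have u3 := hpow 3
  have r0 := psiTrace_add_five 0
  have r1 := psiTrace_add_five 1
  have r2 := psiTrace_add_five 2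
  have r3 := psiTrace_add_five 3
  have r4 := psiTrace_add_five 4
  have r5 := psiTrace_add_five 5
  have k2 := tk 2
  have k4 := tk 4
  have k6 := tk 6
  norm_num only [pow_one] at u1 u2 u3 k2 k4 k6 r0 r1 r2 r3 r4 r5
  rw [u1] at k2
  rw [u2] at k4
  rw [u3] at k6
  generalize (X ^ 3 * expandFive psi ^ 5 : ℤ⟦X⟧) = κ at *
  generalize atkinFive hauptmodul = v1 at *
  generalize atkinFive (hauptmodul ^ 2) = v2 at *
  generalize atkinFive (hauptmodul ^ 3) = v3 at *
  generalize hauptmodul = s at *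
  -- The recurrence coefficients of the traces of index 0, 1, 2 contain enough factors s to absorb
  -- the denominators in `t0`, `t1`, `t2`.
  have t5 : psiTrace 5 = κ * (s - 5 * s ^ 2 + 5 * s ^ 3) := by
    linear_combination r0 + 5 * s * (1 - 5 * s + 5 * s ^ 2) * t4 + 5 * s ^ 2 * (3 - 5 * s) * t3
      + 5 * s * (3 * s - 1) * t2 + -5 * s ^ 2 * t1 + s * t0
  have t6 : psiTrace 6 = κ * (11 * s ^ 2 - 60 * s ^ 3 + 175 * s ^ 4 - 250 * s ^ 5 + 125
      * s ^ 6) := by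
    linear_combination r1 + 5 * s * (1 - 5 * s + 5 * s ^ 2) * t5 + 5 * s ^ 2 * (3 - 5 * s) * t4
      + 5 * s ^ 2 * (3 * s - 1) * t3 + -5 * s ^ 2 * t2 + s ^ 2 * t1
  have t7 : psiTrace 7 = κ * (-3 * s ^ 2 + 79 * s ^ 3 - 675 * s ^ 4 + 2850 * s ^ 5 -
      7250 * s ^ 6 + 11250 * s ^ 7 - 9375 * s ^ 8 + 3125 * s ^ 9) := by
    linear_combination r2 + 5 * s * (1 - 5 * s + 5 * s ^ 2) * t6 + 5 * s ^ 2 * (3 - 5 * s) * t5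
      + 5 * s ^ 2 * (3 * s - 1) * t4 + -5 * s ^ 3 * t3 + s ^ 2 * t2
  have t8 : psiTrace 8 = κ * (-24 * s ^ 3 + 675 * s ^ 4 - 6700 * s ^ 5 + 37300 * s ^ 6 -
      132500 * s ^ 7 + 316875 * s ^ 8 - 512500 * s ^ 9 + 531250 * s ^ 10 - 312500 * s ^ 11 +
      78125 * s ^ 12) := by
    linear_combination r3 + 5 * s * (1 - 5 * s + 5 * s ^ 2) * t7 + 5 * s ^ 2 * (3 - 5 * s) * t6
      + 5 * s ^ 2 * (3 * s - 1) * t5 + -5 * s ^ 3 * t4 + s ^ 3 * t3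
  have t9 : psiTrace 9 = κ * (s ^ 3 - 225 * s ^ 4 + 5725 * s ^ 5 - 64875 * s ^ 6 +
      434375 * s ^ 7 - 1946875 * s ^ 8 + 6181250 * s ^ 9 - 14218750 * s ^ 10 + 23671875 * s ^
      11 - 27734375 * s ^ 12 + 21484375 * s ^ 13 - 9765625 * s ^ 14 + 1953125 * s ^ 15) := by
    linear_combination r4 + 5 * s * (1 - 5 * s + 5 * s ^ 2) * t8 + 5 * s ^ 2 * (3 - 5 * s) * t7
      + 5 * s ^ 2 * (3 * s - 1) * t6 + -5 * s ^ 3 * t5 + s ^ 3 * t4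
  have t10 : psiTrace 10 = κ * (21 * s ^ 4 - 2010 * s ^ 5 + 49865 * s ^ 6 - 615750 * s ^
      7 + 4744125 * s ^ 8 - 25301250 * s ^ 9 + 98718750 * s ^ 10 - 290062500 * s ^ 11 +
      649187500 * s ^ 12 - 1103906250 * s ^ 13 + 1401562500 * s ^ 14 - 1281250000 * s ^ 15 +
      791015625 * s ^ 16 - 292968750 * s ^ 17 + 48828125 * s ^ 18) := by
    linear_combination r5 + 5 * s * (1 - 5 * s + 5 * s ^ 2) * t9 + 5 * s ^ 2 * (3 - 5 * s) * t8
      + 5 * s ^ 2 * (3 * s - 1) * t7 + -5 * s ^ 3 * t6 + s ^ 3 * t5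
  -- The witnesses are the quotients by 25, 25 and 5 after dividing `t6`, `t8`, `t10` by κs, κs^2,
  -- κs^3 and subtracting the stated residues; for example, -60 = 15 - 75.
  refine ⟨⟨-3 * s ^ 2 + 7 * s ^ 3 - 10 * s ^ 4 + 5 * s ^ 5, ?_⟩,
    ⟨-s + 27 * s ^ 2 - 268 * s ^ 3 + 1492 * s ^ 4 - 5300 * s ^ 5 + 12675 * s ^ 6 - 20500 * s
      ^ 7 + 21250 * s ^ 8 - 12500 * s ^ 9 + 3125 * s ^ 10, ?_⟩,
    ⟨4 * s - 402 * s ^ 2 + 9973 * s ^ 3 - 123150 * s ^ 4 + 948825 * s ^ 5 - 5060250 * s ^ 6 +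
      19743750 * s ^ 7 - 58012500 * s ^ 8 + 129837500 * s ^ 9 - 220781250 * s ^ 10 + 280312500
      * s ^ 11 - 256250000 * s ^ 12 + 158203125 * s ^ 13 - 58593750 * s ^ 14 + 9765625 * s ^
      15, ?_⟩⟩
  · refine mul_left_cancel₀ (mul_ne_zero hκ h0) ?_
    linear_combination t6 - k2
  · refine mul_left_cancel₀ (mul_ne_zero hκ (pow_ne_zero 2 h0)) ?_
    linear_combination t8 - k4
  · refine mul_left_cancel₀ (mul_ne_zero hκ (pow_ne_zero 3 h0)) ?_
    linear_combination t10 - k6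

/-- The quotient of the Euler function at `X ^ 2` by the cube of the Euler function, which
generates the broken diamond partitions up to a power series in `X ^ (2 * k + 1)`. -/
noncomputable def brokenDiamondSeries : ℤ⟦X⟧ := eulerF 2 * eulerFInv 1 ^ 3

theorem brokenDiamondSeries_mul : brokenDiamondSeries * eulerF 1 ^ 3 = eulerF 2 := by
  have h := eulerF_mul_inv 1
  rw [brokenDiamondSeries, mul_assoc, ← mul_pow, mul_comm (eulerFInv 1), h, one_pow, mul_one]

/-- By the relations for 1 - 5s and s, the left side is s F_5 / F_10^3. The relation for 1 - s gives
F_1 / F_2^3 = (1 - s) B(q^5), to be taken at q^5. -/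
theorem X_mul_brokenDiamondSeries : X * brokenDiamondSeries * (1 - 5 * hauptmodul)
    = expandFive ((1 - hauptmodul) * expandFive brokenDiamondSeries) * hauptmodul := by
  have h1 := brokenDiamondSeries_mul
  have h5 := congrArg expandFive h1
  rw [map_mul, map_pow, expandFive_eulerF, expandFive_eulerF] at h5
  have hG : (1 - hauptmodul) * expandFive brokenDiamondSeries * eulerF 2 ^ 3 = eulerF 1 := by
    refine mul_right_cancel₀ (pow_ne_zero 3 (eulerF_ne_zero 5)) ?_
    linear_combination (1 - hauptmodul) * eulerF 2 ^ 3 * h5 - eulerF_one_mul_five_cube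
  have hG5 := congrArg expandFive hG
  rw [map_mul, map_pow, expandFive_eulerF, expandFive_eulerF] at hG5
  have h6 := hauptmodul_mul_eulerF
  have h7 := eulerF_one_pow_five_mul_ten
  norm_num only at hG5
  generalize expandFive ((1 - hauptmodul) * expandFive brokenDiamondSeries) = G at *
  refine mul_right_cancel₀ (mul_ne_zero (mul_ne_zero (pow_ne_zero 3 (eulerF_ne_zero 1))
    (pow_ne_zero 4 (eulerF_ne_zero 2)))
    (mul_ne_zero (pow_ne_zero 2 (eulerF_ne_zero 5)) (pow_ne_zero 3 (eulerF_ne_zero 10)))) ?_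
  linear_combination
    (X * (1 - 5 * hauptmodul) * eulerF 2 ^ 4 * eulerF 5 ^ 2 * eulerF 10 ^ 3) * h1
    - X * eulerF 5 * eulerF 10 ^ 3 * h7
    - hauptmodul * eulerF 1 ^ 3 * eulerF 2 ^ 4 * eulerF 5 ^ 2 * hG5
    - eulerF 5 * eulerF 1 ^ 3 * h6

theorem atkinFive_natCast_mul (n : ℕ) (f : ℤ⟦X⟧) :
    atkinFive ((n : ℤ⟦X⟧) * f) = n * atkinFive f := by
  rw [← nsmul_eq_mul, ← nsmul_eq_mul, map_nsmul]

/-- Multiplying by 1 + 5s inverts 1 - 5s up to 25s^2; the series in X^5 then leaves the operator. -/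
theorem atkinFive_X_mul_brokenDiamondSeries_mul (P : ℤ⟦X⟧) : ∃ g,
    atkinFive (X * brokenDiamondSeries * P) = expandFive brokenDiamondSeries
      * ((1 - hauptmodul) * atkinFive ((hauptmodul + 5 * hauptmodul ^ 2) * P)) + 25 * g := by
  have h : X * brokenDiamondSeries * P
      = expandFive ((1 - hauptmodul) * expandFive brokenDiamondSeries)
        * ((hauptmodul + 5 * hauptmodul ^ 2) * P)
        + ((25 : ℕ) : ℤ⟦X⟧) * (hauptmodul ^ 2 * X * brokenDiamondSeries * P) := by
    push_cast
    linear_combination ((1 + 5 * hauptmodul) * P) * X_mul_brokenDiamondSeries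
  refine ⟨atkinFive (hauptmodul ^ 2 * X * brokenDiamondSeries * P), ?_⟩
  rw [h, map_add, atkinFive_expandFive_mul, atkinFive_natCast_mul]
  push_cast
  ring

/-- The first step gives B(q^5) (1 - s)(16s + 15s^2), that is, B(q^5) (16s - s^2 - 15s^3) modulo 25.
The second gives 16(11s + 15s^2) - s - 15s = 160s + 240s^2, which is 10(s - s^2) modulo 25. The
coefficient 15 is why U(s^3) is only needed modulo 5. -/
theorem atkinFive_atkinFive_X_mul_brokenDiamondSeries : ∃ g,
    atkinFive (atkinFive (X * brokenDiamondSeries))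
      = brokenDiamondSeries * (10 * (hauptmodul - hauptmodul ^ 2)) + 25 * g := by
  obtain ⟨⟨g₁, h₁⟩, ⟨g₂, h₂⟩, g₃, h₃⟩ := atkinFive_hauptmodul_pow_congr
  obtain ⟨g, hg⟩ := atkinFive_X_mul_brokenDiamondSeries_mul 1
  rw [mul_one, mul_one] at hg
  have e1 : atkinFive (hauptmodul + 5 * hauptmodul ^ 2)
      = 16 * hauptmodul + 15 * hauptmodul ^ 2 + 25 * (g₁ + 5 * g₂) := by
    have := atkinFive_natCast_mul 5 (hauptmodul ^ 2)
    push_cast at this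
    rw [map_add, this, h₁, h₂]
    ring
  have e2 : atkinFive (X * brokenDiamondSeries) = expandFive brokenDiamondSeries
      * (((16 : ℕ) : ℤ⟦X⟧) * hauptmodul + -(hauptmodul ^ 2)
        + -(((15 : ℕ) : ℤ⟦X⟧) * hauptmodul ^ 3))
      + ((25 : ℕ) : ℤ⟦X⟧)
        * (expandFive brokenDiamondSeries * ((1 - hauptmodul) * (g₁ + 5 * g₂)) + g) := by
    rw [hg, e1]
    push_cast
    ring
  refine ⟨brokenDiamondSeries * (6 * hauptmodul + 10 * hauptmodul ^ 2 + 16 * g₁ - g₂ - 3 * g₃)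
    + atkinFive (expandFive brokenDiamondSeries * ((1 - hauptmodul) * (g₁ + 5 * g₂)) + g), ?_⟩
  rw [e2, map_add, atkinFive_expandFive_mul, atkinFive_natCast_mul, map_add, map_add, map_neg,
    map_neg, atkinFive_natCast_mul, atkinFive_natCast_mul, h₁, h₂, h₃]
  push_cast
  ring

/-- In the third step 10(s - s^2)(s + 5s^2) is 10(s^2 - s^3) modulo 25, and U(s^2) and U(s^3) are
both s modulo 5. -/
theorem dvd_coeff_brokenDiamondSeries (n : ℕ) : 25 ∣ coeff (125 * n + 99) brokenDiamondSeries := by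
  obtain ⟨⟨g₁, h₁⟩, ⟨g₂, h₂⟩, g₃, h₃⟩ := atkinFive_hauptmodul_pow_congr
  obtain ⟨g, hg⟩ := atkinFive_atkinFive_X_mul_brokenDiamondSeries
  obtain ⟨g', hg'⟩ := atkinFive_X_mul_brokenDiamondSeries_mul
    (((10 : ℕ) : ℤ⟦X⟧) * (hauptmodul - hauptmodul ^ 2))
  have e1 : (hauptmodul + 5 * hauptmodul ^ 2) * (((10 : ℕ) : ℤ⟦X⟧) * (hauptmodul - hauptmodul ^ 2))
      = ((10 : ℕ) : ℤ⟦X⟧) * (hauptmodul ^ 2 - hauptmodul ^ 3)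
        + ((50 : ℕ) : ℤ⟦X⟧) * (hauptmodul ^ 3 - hauptmodul ^ 4) := by
    push_cast
    ring
  have e2 : X * atkinFive (atkinFive (X * brokenDiamondSeries))
      = X * brokenDiamondSeries * (((10 : ℕ) : ℤ⟦X⟧) * (hauptmodul - hauptmodul ^ 2))
        + ((25 : ℕ) : ℤ⟦X⟧) * (X * g) := by
    rw [hg]
    push_cast
    ring
  rw [e1, map_add, atkinFive_natCast_mul, atkinFive_natCast_mul, map_sub, h₂, h₃] at hg'
  have key : ∃ r, atkinFive (X * atkinFive (atkinFive (X * brokenDiamondSeries)))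
      = ((25 : ℕ) : ℤ⟦X⟧) * r := by
    rw [e2, map_add, atkinFive_natCast_mul, hg']
    refine ⟨expandFive brokenDiamondSeries * ((1 - hauptmodul) * (10 * g₂ - 2 * g₃
      + 2 * atkinFive (hauptmodul ^ 3 - hauptmodul ^ 4))) + g' + atkinFive (X * g), ?_⟩
    push_cast
    ring
  obtain ⟨r, hr⟩ := key
  have hc := congrArg (coeff (n + 1)) hr
  -- The extra X before the third operator turns index 5n + 5 into 5n + 4; then 25(5n + 4) = 125n +
  -- 100, and the first X lowers this to 125n + 99.
  rw [coeff_atkinFive, mul_add, coeff_succ_X_mul, coeff_atkinFive, coeff_atkinFive,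
    show 5 * (5 * (5 * n + 4)) = 125 * n + 99 + 1 by ring, coeff_succ_X_mul, ← nsmul_eq_mul,
    map_nsmul, nsmul_eq_mul] at hc
  exact ⟨_, by exact_mod_cast hc⟩

end Congruences

/-! ### Labellings of chains of layers and partitions -/

section Chains

/-- The partition conjugate to the one with the given parts. -/
noncomputable def conjugateParts (s : Multiset ℕ) : ℕ →₀ ℕ :=
  (s.map fun x => ∑ v ∈ Finset.range x, Finsupp.single v 1).sum

theorem conjugateParts_cons (x : ℕ) (s : Multiset ℕ) : conjugateParts (x ::ₘ s)
    = (∑ v ∈ Finset.range x, Finsupp.single v 1) + conjugateParts s := by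
  simp [conjugateParts]

theorem sum_conjugateParts (s : Multiset ℕ) :
    ((conjugateParts s).sum fun _ x => x) = s.sum := by
  induction s using Multiset.induction with
  | empty => simp [conjugateParts]
  | cons x s ih =>
    rw [conjugateParts_cons, Finsupp.sum_add_index' (by simp) (by simp), ih, Multiset.sum_cons,
      ← Finsupp.sum_finsetSum_index (by simp) (by simp)]
    simp

/-- A descent from v to v + 1 counts the parts equal to v + 1; this shift by one is why a part i
belongs to the pair {i - 1, i}. -/
theorem conjugateParts_apply (s : Multiset ℕ) (v : ℕ) :
    conjugateParts s v = conjugateParts s (v + 1) + s.count (v + 1) := by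
  induction s using Multiset.induction with
  | empty => simp [conjugateParts]
  | cons x s ih =>
    have h : ∀ w, (∑ v ∈ Finset.range x, Finsupp.single v 1 : ℕ →₀ ℕ) w
        = if w < x then 1 else 0 := by
      intro w
      rw [Finsupp.finsetSum_apply]
      simp [Finsupp.single_apply]
    rw [conjugateParts_cons, Finsupp.add_apply, Finsupp.add_apply, ih, h, h, Multiset.count_cons]
    split_ifs <;> omega

theorem conjugateParts_antitone (s : Multiset ℕ) : Antitone (conjugateParts s) :=
  antitone_nat_of_succ_le fun v => by rw [conjugateParts_apply s v]; omega

/-- Both functions vanish far out, so the differences determine them by downward induction. -/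
theorem Finsupp.eq_of_sub_eq {f g : ℕ →₀ ℕ} {c : ℕ → ℕ} (hf : ∀ v, f v = f (v + 1) + c v)
    (hg : ∀ v, g v = g (v + 1) + c v) : f = g := by
  obtain ⟨N, hN⟩ : ∃ N, ∀ v, N ≤ v → f v = 0 ∧ g v = 0 := by
    refine ⟨(f.support ∪ g.support).sup id + 1, fun v hv => ?_⟩
    by_contra h
    have : v ∈ f.support ∪ g.support := by
      rw [Finset.mem_union, Finsupp.mem_support_iff, Finsupp.mem_support_iff]
      tauto
    have := Finset.le_sup (f := id) this
    simp only [id] at this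
    omega
  have key : ∀ m v, N ≤ v + m → f v = g v := by
    intro m
    induction m with
    | zero => intro v hv; rw [(hN v hv).1, (hN v hv).2]
    | succ m ih => intro v hv; rw [hf, hg, ih (v + 1) (by omega)]
  ext v
  exact key N v (by omega)

theorem exists_conjugateParts_eq {f : ℕ →₀ ℕ} (hf : Antitone f) :
    ∃ s : Multiset ℕ, 0 ∉ s ∧ conjugateParts s = f := by
  have hs : ∀ v, v ∉ f.support → f v - f (v + 1) = 0 := by
    intro v hv
    rw [Finsupp.notMem_support_iff.1 hv, Nat.zero_sub]
  refine ⟨∑ v ∈ f.support, Multiset.replicate (f v - f (v + 1)) (v + 1), ?_, ?_⟩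
  · simp [Multiset.mem_sum, Multiset.mem_replicate]
  · refine Finsupp.eq_of_sub_eq (conjugateParts_apply _) fun v => ?_
    have h := hf (Nat.le_succ v)
    simp only [Nat.succ_eq_add_one] at h
    have : Multiset.count (v + 1) (∑ v ∈ f.support, Multiset.replicate (f v - f (v + 1)) (v + 1))
        = f v - f (v + 1) := by
      rw [Multiset.count_sum']
      simp only [Multiset.count_replicate, Nat.add_right_cancel_iff]
      rw [Finset.sum_ite_eq']
      split_ifs with h
      · rfl
      · exact (hs v h).symm
    rw [this]
    omega

theorem conjugateParts_injective {s t : Multiset ℕ} (hs : 0 ∉ s) (ht : 0 ∉ t)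
    (h : conjugateParts s = conjugateParts t) : s = t := by
  ext i
  cases i with
  | zero => rw [Multiset.count_eq_zero_of_notMem hs, Multiset.count_eq_zero_of_notMem ht]
  | succ v =>
    have h1 := conjugateParts_apply s v
    have h2 := conjugateParts_apply t v
    rw [h] at h1
    omega

/-- The map exchanging `i - 1` and `i` for every `i` in `E`. -/
def adjacentSwap (E : Finset ℕ) (v : ℕ) : ℕ :=
  if v + 1 ∈ E then v + 1 else if v ∈ E then v - 1 else v

theorem adjacentSwap_involutive {E : Finset ℕ} (h0 : 0 ∉ E) (hE : ∀ i ∈ E, i + 1 ∉ E) :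
    Function.Involutive (adjacentSwap E) := by
  intro v
  have h1 := hE (v + 1)
  have h2 := hE v
  by_cases hv : v + 1 ∈ E
  · simp [adjacentSwap, hv, h1 hv]
  · by_cases hv' : v ∈ E
    · cases v with
      | zero => exact absurd hv' h0
      | succ w => simp [adjacentSwap, hv, hv']
    · simp [adjacentSwap, hv, hv']

/-- The labelling `f` decreases weakly from each layer of a chain to the next ones, where
the layers are the pairs `{u, u + 1}` with `q u` and the remaining single vertices. -/
def LayerAntitone (q : ℕ → Prop) (f : ℕ → ℕ) : Prop :=
  ∀ u w, u < w → ¬(q u ∧ w = u + 1) → f w ≤ f u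

variable {q : ℕ → Prop}

/-- Swaps take place only inside layers, and `hq` makes the two-element layers disjoint, so order
between different layers is unaffected. -/
theorem layerAntitone_comp_adjacentSwap (hq : ∀ u, q u → ¬ q (u + 1)) {E : Finset ℕ}
    (hE : ∀ i ∈ E, q (i - 1)) {f : ℕ → ℕ} (hf : Antitone f) :
    LayerAntitone q (f ∘ adjacentSwap E) := by
  intro u w huw hp
  apply hf
  have hu := hE (u + 1)
  have hw := hE w
  have hqu := hq u
  simp only [Nat.add_sub_cancel] at hu
  unfold adjacentSwap
  have hw0 : w ∈ E → w - 1 = u + 1 → u + 1 ∈ E → False := by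
    intro h1 h2 h3
    exact hqu (hu h3) (h2 ▸ hw h1)
  have hu1 : u + 1 ∈ E → w ≠ u + 1 := fun h1 h2 => hp ⟨hu h1, h2⟩
  split_ifs <;> try omega
  · rename_i h1 h2 h3
    have := hu1 h1
    by_contra h
    exact hw0 h3 (by omega) h1

/-- The converse direction: exchanging exactly the pairs that increase sorts a layered labelling. -/
theorem antitone_comp_adjacentSwap (hq : ∀ u, q u → ¬ q (u + 1)) {E : Finset ℕ}
    {f : ℕ → ℕ} (h0 : 0 ∉ E) (hE : ∀ v, v + 1 ∈ E ↔ q v ∧ f v < f (v + 1))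
    (hf : LayerAntitone q f) :
    Antitone (f ∘ adjacentSwap E) := by
  refine antitone_nat_of_succ_le fun v => ?_
  have hE' : ∀ v, v ∈ E → 0 < v ∧ q (v - 1) ∧ f (v - 1) < f v := by
    intro v hv
    cases v with
    | zero => exact absurd hv h0
    | succ v => exact ⟨by omega, (hE v).1 hv⟩
  simp only [Function.comp, adjacentSwap]
  by_cases h1 : v + 1 ∈ E
  · have h2 : v + 1 + 1 ∉ E := fun h => hq v ((hE v).1 h1).1 ((hE (v + 1)).1 h).1
    rw [if_neg h2, if_pos h1, if_pos h1]
    exact ((hE v).1 h1).2.le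
  · rw [if_neg h1, if_neg h1]
    by_cases hqv : q v
    · have h2 : v + 1 + 1 ∉ E := fun h => hq v hqv ((hE (v + 1)).1 h).1
      have h3 : v ∉ E := by
        intro h
        have := hE' v h
        refine hq (v - 1) this.2.1 ?_
        rwa [Nat.sub_add_cancel this.1]
      rw [if_neg h2, if_neg h3]
      by_contra h
      exact h1 ((hE v).2 ⟨hqv, by omega⟩)
    · split_ifs with h2 h3 h3
      · exact hf _ _ (by omega) (by omega)
      · exact hf _ _ (by omega) (fun h => hqv h.1)
      · have := (hE' v h3).1
        exact hf _ _ (by omega) (by omega)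
      · exact hf _ _ (by omega) (fun h => hqv h.1)


theorem LayerAntitone.step {f : ℕ → ℕ} (hf : LayerAntitone q f) (v : ℕ) : f (v + 2) ≤ f v :=
  hf _ _ (by omega) (by omega)

variable (q) in
/-- The labellings with total `n` that decrease weakly along the layers. -/
def layerPartitions (n : ℕ) : Set (ℕ →₀ ℕ) :=
  {f | LayerAntitone q f ∧ (f.sum fun _ x => x) = n}

theorem layerPartitions_finite (n : ℕ) : (layerPartitions q n).Finite := by
  refine Set.Finite.subset
    ((Finset.range (2 * n)).finsupp fun _ => Finset.range (n + 1)).finite_toSet ?_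
  rintro f ⟨hf, hs⟩
  exact Finsupp.mem_box_of_step (fun v => hf.step v) hs.le

/-- A labelling corresponds to the conjugate partition of its sorted form together with the set of
pairs that had to be exchanged. Only pairs with a strict descent matter, and these are the distinct
parts i with q(i - 1). -/
theorem ncard_layerPartitions [DecidablePred q] (hq : ∀ u, q u → ¬ q (u + 1)) (n : ℕ) :
    (layerPartitions q n).ncard
      = ∑ p : n.Partition, 2 ^ {i ∈ p.parts.toFinset | q (i - 1)}.card := by
  classical
  have hE : ∀ (p : n.Partition), ∀ E ⊆ {i ∈ p.parts.toFinset | q (i - 1)},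
      0 ∉ E ∧ (∀ i ∈ E, i + 1 ∉ E) ∧ (∀ i ∈ E, q (i - 1)) ∧ ∀ i ∈ E, i ∈ p.parts := by
    intro p E hE
    have h1 : ∀ i ∈ E, i ∈ p.parts ∧ q (i - 1) := fun i hi => by simpa using hE hi
    have h0 : 0 ∉ E := fun h => absurd (p.parts_pos (h1 0 h).1) (lt_irrefl 0)
    refine ⟨h0, fun i hi hi' => ?_, fun i hi => (h1 i hi).2, fun i hi => (h1 i hi).1⟩
    have hi0 : i ≠ 0 := fun h => h0 (h ▸ hi)
    refine hq (i - 1) (h1 i hi).2 ?_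
    rw [Nat.sub_add_cancel (Nat.pos_of_ne_zero hi0)]
    exact (h1 _ hi').2
  have hinv : ∀ (p : n.Partition), ∀ E ⊆ {i ∈ p.parts.toFinset | q (i - 1)},
      Function.Involutive (adjacentSwap E) := fun p E h =>
    adjacentSwap_involutive (hE p E h).1 (hE p E h).2.1
  let S := Finset.univ.sigma fun p : n.Partition => {i ∈ p.parts.toFinset | q (i - 1)}.powerset
  let Φ : (x : Σ _ : n.Partition, Finset ℕ) → x ∈ S → ℕ →₀ ℕ := fun x hx =>
    (conjugateParts x.1.parts).equivMapDomain
      (hinv x.1 x.2 (Finset.mem_powerset.1 (Finset.mem_sigma.1 hx).2)).toPerm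
  have hcard : S.card = ∑ p : n.Partition, 2 ^ {i ∈ p.parts.toFinset | q (i - 1)}.card := by
    simp [S, Finset.card_sigma, Finset.card_powerset]
  have hΦ : ∀ x hx, ⇑(Φ x hx) = conjugateParts x.1.parts ∘ adjacentSwap x.2 := fun x hx => rfl
  rw [← hcard, Set.ncard_eq_toFinset_card _ (layerPartitions_finite n), eq_comm]
  refine Finset.card_bij Φ ?_ ?_ ?_
  · intro x hx
    have h := hE x.1 x.2 (Finset.mem_powerset.1 (Finset.mem_sigma.1 hx).2)
    rw [Set.Finite.mem_toFinset]
    refine ⟨?_, ?_⟩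
    · rw [hΦ x hx]
      exact layerAntitone_comp_adjacentSwap hq h.2.2.1 (conjugateParts_antitone _)
    · simp only [Φ]
      rw [Finsupp.sum_equivMapDomain, sum_conjugateParts, x.1.parts_sum]
  -- The set of exchanged pairs is recovered as the set of pairs that increase, which is injectivity
  -- in the second component.
  · have key : ∀ x hx v, v + 1 ∈ x.2 ↔ q v ∧ Φ x hx v < Φ x hx (v + 1) := by
      intro x hx v
      have h := hE x.1 x.2 (Finset.mem_powerset.1 (Finset.mem_sigma.1 hx).2)
      rw [hΦ x hx]
      simp only [Function.comp]
      by_cases hv : v + 1 ∈ x.2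
      · have h1 := h.2.2.1 _ hv
        have h2 : (v + 1) + 1 ∉ x.2 := h.2.1 _ hv
        have h3 := Multiset.one_le_count_iff_mem.2 (h.2.2.2 _ hv)
        have h4 := conjugateParts_apply x.1.parts v
        simp only [Nat.add_sub_cancel] at h1
        simp only [adjacentSwap, hv, h1, h2, if_true, if_false, Nat.add_sub_cancel, true_and,
          true_iff]
        omega
      · refine iff_of_false hv ?_
        rintro ⟨h1, h2⟩
        have h3 : (v + 1) + 1 ∉ x.2 := fun h' => hq v h1 (h.2.2.1 _ h')
        have h4 : v ∉ x.2 := by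
          intro h'
          have h5 : v ≠ 0 := fun h0 => h.1 (h0 ▸ h')
          refine hq (v - 1) (h.2.2.1 _ h') ?_
          rwa [Nat.sub_add_cancel (Nat.pos_of_ne_zero h5)]
        simp only [adjacentSwap, hv, h3, h4, if_false] at h2
        have := conjugateParts_antitone x.1.parts (Nat.le_succ v)
        simp only [Nat.succ_eq_add_one] at this
        omega
    rintro ⟨p, E⟩ hx ⟨p', E'⟩ hx' heq
    have hEE : E = E' := by
      ext i
      cases i with
      | zero =>
        exact iff_of_false (hE _ _ (Finset.mem_powerset.1 (Finset.mem_sigma.1 hx).2)).1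
          (hE _ _ (Finset.mem_powerset.1 (Finset.mem_sigma.1 hx').2)).1
      | succ v =>
        have h1 := key _ hx v
        have h2 := key _ hx' v
        rw [heq] at h1
        exact h1.trans h2.symm
    subst hEE
    have hpp : p = p' := by
      ext1
      refine conjugateParts_injective (fun h => absurd (p.parts_pos h) (lt_irrefl 0))
        (fun h => absurd (p'.parts_pos h) (lt_irrefl 0)) ?_
      have h1 : ⇑(Φ _ hx) = ⇑(Φ _ hx') := by rw [heq]
      rw [hΦ _ hx, hΦ _ hx'] at h1
      have hsurj := (hinv p E (Finset.mem_powerset.1 (Finset.mem_sigma.1 hx).2)).surjective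
      exact DFunLike.coe_injective (hsurj.injective_comp_right h1)
    rw [hpp]
  · intro f hf
    obtain ⟨hf, hs⟩ := (Set.Finite.mem_toFinset _).1 hf
    let E : Finset ℕ := {i ∈ f.support | i ≠ 0 ∧ q (i - 1) ∧ f (i - 1) < f i}
    have h0 : 0 ∉ E := by simp [E]
    have hmem : ∀ v, v + 1 ∈ E ↔ q v ∧ f v < f (v + 1) := by
      intro v
      simp only [E, Finset.mem_filter, Finsupp.mem_support_iff, Nat.add_sub_cancel]
      constructor
      · exact fun h => h.2.2
      · exact fun h => ⟨by omega, by omega, h⟩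
    have hE1 : ∀ i ∈ E, i + 1 ∉ E := by
      intro i hi hi'
      cases i with
      | zero => exact h0 hi
      | succ v => exact hq v ((hmem v).1 hi).1 ((hmem (v + 1)).1 hi').1
    have hσ := adjacentSwap_involutive h0 hE1
    have hanti := antitone_comp_adjacentSwap hq h0 hmem hf
    obtain ⟨s, hs0, hsf⟩ := exists_conjugateParts_eq (f := f.equivMapDomain hσ.toPerm) hanti
    have hsf' : ∀ v, conjugateParts s v = f (adjacentSwap E v) := fun v => by rw [hsf]; rfl
    have hsum : s.sum = n := by
      rw [← sum_conjugateParts, hsf, Finsupp.sum_equivMapDomain, hs]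
    let p : n.Partition := ⟨s, fun hi => Nat.pos_of_ne_zero fun h => hs0 (h ▸ hi), hsum⟩
    have hES : (⟨p, E⟩ : Σ _ : n.Partition, Finset ℕ) ∈ S := by
      refine Finset.mem_sigma.2 ⟨Finset.mem_univ _, Finset.mem_powerset.2 fun i hi => ?_⟩
      cases i with
      | zero => exact absurd hi h0
      | succ v =>
        have h1 := (hmem v).1 hi
        rw [Finset.mem_filter, Multiset.mem_toFinset]
        refine ⟨?_, h1.1⟩
        change v + 1 ∈ s
        have h2 := conjugateParts_apply s v
        rw [hsf', hsf'] at h2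
        have h3 : adjacentSwap E v = v + 1 := if_pos hi
        have h4 : adjacentSwap E (v + 1) = v := by rw [← h3, hσ]
        rw [h3, h4] at h2
        exact Multiset.one_le_count_iff_mem.1 (by have := h1.2; omega)
    refine ⟨⟨p, E⟩, hES, DFunLike.coe_injective ?_⟩
    rw [hΦ _ hES]
    ext v
    simp only [Function.comp, p]
    rw [hsf', hσ]

/-- The generating function of the labellings that decrease weakly along the layers. -/
theorem mk_ncard_layerPartitions_eq_genFun [DecidablePred q] (hq : ∀ u, q u → ¬ q (u + 1)) :
    (mk fun n => ((layerPartitions q n).ncard : ℤ))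
      = Nat.Partition.genFun fun i _ => if q (i - 1) then 2 else 1 := by
  ext n
  rw [coeff_mk, ncard_layerPartitions hq, Nat.Partition.coeff_genFun]
  push_cast
  refine Finset.sum_congr rfl fun p _ => ?_
  rw [Finsupp.prod, Multiset.toFinsupp_support, ← Finset.prod_filter, Finset.prod_const]

end Chains

/-! ### The generating function of broken diamond partitions -/

section DiamondChains

variable {k : ℕ}

theorem DiamondEdge.lt_and_not_pair {u v : ℕ} (h : DiamondEdge k u v) :
    u < v ∧ ¬(u % (2 * k + 1) % 2 = 1 ∧ v = u + 1) := by
  cases h with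
  | first j e hk he =>
    refine ⟨by omega, fun h => ?_⟩
    rw [Nat.mul_mod_right] at h
    omega
  | cross j i e f hi he hf =>
    refine ⟨by omega, fun h => ?_⟩
    have h1 : e = 1 := by omega
    have h2 : 2 * i + 1 + e < 2 * k + 1 := by omega
    rw [add_assoc, Nat.mul_add_mod, Nat.mod_eq_of_lt h2] at h
    omega
  | last j i e hi he =>
    have h1 : (2 * k + 1) * (j + 1) = (2 * k + 1) * j + (2 * k + 1) := by ring
    refine ⟨by omega, fun h => ?_⟩
    have h2 : 2 * i + 1 + e < 2 * k + 1 := by omega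
    rw [add_assoc, Nat.mul_add_mod, Nat.mod_eq_of_lt h2] at h
    omega

theorem DiamondEdge.of_not_odd (hk : 0 < k) {v : ℕ} (hv : ¬ v % (2 * k + 1) % 2 = 1) :
    DiamondEdge k v (v + 1) := by
  obtain ⟨j, r, hr, rfl⟩ : ∃ j r, r < 2 * k + 1 ∧ v = (2 * k + 1) * j + r :=
    ⟨v / (2 * k + 1), v % (2 * k + 1), Nat.mod_lt _ (by omega), (Nat.div_add_mod _ _).symm⟩
  rw [Nat.mul_add_mod, Nat.mod_eq_of_lt hr] at hv
  rcases Nat.eq_zero_or_pos r with rfl | hr0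
  · exact DiamondEdge.first j 0 hk (by norm_num)
  obtain ⟨i, rfl⟩ : ∃ i, r = 2 * i + 1 + 1 := ⟨(r - 2) / 2, by omega⟩
  rcases Nat.lt_or_ge (i + 1) k with hi | hi
  · have h := DiamondEdge.cross j i 1 0 hi (by norm_num) (by norm_num)
    convert h using 1 <;> ring
  · have hi' : i + 1 = k := by omega
    have h := DiamondEdge.last j i 1 hi' (by norm_num)
    subst hi'
    convert h using 1 <;> ring

/-- The edge from the first vertex of a pair to the second vertex of the next pair, the one
comparison at distance 3 not implied by those at distance 1 and 2. -/
theorem DiamondEdge.of_odd {v : ℕ} (hv : v % (2 * k + 1) % 2 = 1)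
    (hv' : (v + 2) % (2 * k + 1) % 2 = 1) : DiamondEdge k v (v + 3) := by
  obtain ⟨j, r, hr, rfl⟩ : ∃ j r, r < 2 * k + 1 ∧ v = (2 * k + 1) * j + r :=
    ⟨v / (2 * k + 1), v % (2 * k + 1), Nat.mod_lt _ (by omega), (Nat.div_add_mod _ _).symm⟩
  rw [Nat.mul_add_mod, Nat.mod_eq_of_lt hr] at hv
  rw [add_assoc, Nat.mul_add_mod] at hv'
  obtain ⟨i, rfl⟩ : ∃ i, r = 2 * i + 1 := ⟨r / 2, by omega⟩
  rcases Nat.lt_or_ge (i + 1) k with hi | hi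
  · have h := DiamondEdge.cross j i 0 1 hi (by norm_num) (by norm_num)
    convert h using 1 <;> ring
  · rw [show 2 * i + 1 + 2 = 2 * k + 1 by omega, Nat.mod_self] at hv'
    omega

/-- Edges yield every comparison at distance 2 or 3, and at distance 1 unless the two vertices form
a pair. Even distances are sums of 2's, odd distances from 3 on are one 3 and 2's. The shift s is 0
for the full chain and 1 for the chain without its source. -/
theorem layerAntitone_iff_diamondEdge (hk : 0 < k) (s : ℕ) (f : ℕ → ℕ) :
    LayerAntitone (fun u => (u + s) % (2 * k + 1) % 2 = 1) f
      ↔ ∀ u v, DiamondEdge k (u + s) (v + s) → f v ≤ f u := by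
  constructor
  · intro hf u v h
    have h1 := h.lt_and_not_pair
    exact hf u v (by omega) fun h2 => h1.2 ⟨h2.1, by omega⟩
  · intro hf
    have h2 : ∀ v, f (v + 2) ≤ f v := by
      intro v
      rcases DiamondEdge.step hk (v + s) with h | ⟨h, h'⟩
      · exact hf v (v + 2) (by convert h using 1; omega)
      · exact (hf (v + 1) (v + 2) (by convert h' using 1 <;> omega)).trans
          (hf v (v + 1) (by convert h using 1; omega))
    have h1 : ∀ v, ¬ (v + s) % (2 * k + 1) % 2 = 1 → f (v + 1) ≤ f v := by
      intro v h
      exact hf v (v + 1) (by convert DiamondEdge.of_not_odd hk h using 1; omega)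
    have h3 : ∀ v, f (v + 3) ≤ f v := by
      intro v
      by_cases hv : (v + s) % (2 * k + 1) % 2 = 1
      · by_cases hv' : (v + 2 + s) % (2 * k + 1) % 2 = 1
        · refine hf v (v + 3) ?_
          convert DiamondEdge.of_odd hv (by convert hv' using 3; omega) using 1
          omega
        · exact (h1 (v + 2) hv').trans (h2 v)
      · exact (h2 (v + 1)).trans (h1 v hv)
    have hm : ∀ m v, f (v + 2 * m) ≤ f v := by
      intro m
      induction m with
      | zero => intro v; exact le_rfl
      | succ m ih => intro v; exact (h2 (v + 2 * m)).trans (ih v)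
    intro u w huw hp
    obtain ⟨m, hm' | hm'⟩ : ∃ m, w = u + 2 * m ∨ w = u + 2 * m + 1 :=
      ⟨(w - u) / 2, by omega⟩
    · rw [hm']
      exact hm m u
    · cases m with
      | zero =>
        rw [hm']
        exact h1 u fun h => hp ⟨h, by omega⟩
      | succ m =>
        rw [hm', show u + 2 * (m + 1) + 1 = u + 3 + 2 * m by omega]
        exact (hm m _).trans (h3 u)

theorem brokenDiamondCount_eq_sum (hk : 0 < k) (n : ℕ) :
    brokenDiamondCount k n = ∑ x ∈ Finset.HasAntidiagonal.antidiagonal n,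
      (layerPartitions (fun u => (u + 0) % (2 * k + 1) % 2 = 1) x.1).ncard
      * (layerPartitions (fun u => (u + 1) % (2 * k + 1) % 2 = 1) x.2).ncard := by
  classical
  have hmem : ∀ p, p ∈ brokenDiamondPartitions k n ↔
      LayerAntitone (fun u => (u + 0) % (2 * k + 1) % 2 = 1) p.1 ∧
      LayerAntitone (fun u => (u + 1) % (2 * k + 1) % 2 = 1) p.2 ∧
      (p.1.sum fun _ x => x) + (p.2.sum fun _ x => x) = n := by
    intro p
    rw [layerAntitone_iff_diamondEdge hk, layerAntitone_iff_diamondEdge hk]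
    rfl
  rw [brokenDiamondCount, Set.ncard_eq_toFinset_card _ (brokenDiamondPartitions_finite hk n),
    Finset.card_eq_sum_card_fiberwise (t := Finset.HasAntidiagonal.antidiagonal n)
      (f := fun p => (p.1.sum fun _ x => x, p.2.sum fun _ x => x))]
  · refine Finset.sum_congr rfl fun x hx => ?_
    rw [Set.ncard_eq_toFinset_card _ (layerPartitions_finite x.1),
      Set.ncard_eq_toFinset_card _ (layerPartitions_finite x.2), ← Finset.card_product]
    congr 1
    ext p
    simp only [Finset.mem_filter, Set.Finite.mem_toFinset, Finset.mem_product, hmem,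
      layerPartitions, Set.mem_ofPred_eq, Prod.ext_iff]
    rw [Finset.HasAntidiagonal.mem_antidiagonal] at hx
    constructor
    · rintro ⟨⟨h1, h2, -⟩, h3, h4⟩
      exact ⟨⟨h1, h3⟩, h2, h4⟩
    · rintro ⟨⟨h1, h3⟩, h2, h4⟩
      exact ⟨⟨h1, h2, by rw [h3, h4, hx]⟩, h3, h4⟩
  · intro p hp
    rw [Finset.mem_coe, Set.Finite.mem_toFinset, hmem] at hp
    exact Finset.HasAntidiagonal.mem_antidiagonal.2 hp.2.2

theorem eulerF_two_mul_eq_tprod (m : ℕ) : eulerF (2 * m)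
    = ∏' n, (1 - X ^ (2 * (n + 1))) ^ (if m ∣ n + 1 then 1 else 0) := by
  rw [← expand_eulerF two_ne_zero, eulerF, eulerProd,
    Multipliable.map_tprod (multipliable_one_sub_X_pow_pow (fun n => n.le_succ) _) _
    (continuous_expand two_ne_zero)]
  simp only [map_pow, map_sub, map_one, expand_X, ← pow_mul]

/-- A geometric series: weight c per distinct part gives (1 + (c - 1)x)/(1 - x), which is 1/(1 - x)
for c = 1 and (1 + x)/(1 - x) for c = 2. -/
theorem one_add_tsum_mul_one_sub {R : Type*} [CommRing R] [TopologicalSpace R]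
    [IsTopologicalRing R] [T2Space R] {f : ℕ → ℕ → R} {i : ℕ} {c : R}
    (hf : ∀ j, f (i + 1) (j + 1) = c) :
    (1 + ∑' j, f (i + 1) (j + 1) • (X : R⟦X⟧) ^ ((i + 1) * (j + 1))) * (1 - X ^ (i + 1))
      = 1 + C (c - 1) * X ^ (i + 1) := by
  have h : (∑' j, f (i + 1) (j + 1) • (X : R⟦X⟧) ^ ((i + 1) * (j + 1))) * (1 - X ^ (i + 1))
      = C c * X ^ (i + 1) := by
    have hs := Nat.Partition.summable_genFun_term f i
    simp only [hf] at hs ⊢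
    have h0 := hs.tsum_eq_zero_add
    have h1 : ∑' j, c • (X : R⟦X⟧) ^ ((i + 1) * (j + 1 + 1))
        = (∑' j, c • (X : R⟦X⟧) ^ ((i + 1) * (j + 1))) * X ^ (i + 1) := by
      rw [← hs.tsum_mul_right]
      refine tsum_congr fun j => ?_
      rw [smul_mul_assoc, ← pow_add]
      ring_nf
    rw [h1] at h0
    rw [mul_one_sub, sub_eq_iff_eq_add]
    refine h0.trans ?_
    rw [zero_add, mul_one, smul_eq_C_mul]
  rw [add_mul, h, map_sub, map_one]
  ring

/-- For a part i = n + 1 the two chains test whether n and n + 1 have odd residue modulo 2k + 1.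
Exactly one does, unless 2k + 1 divides i, when neither does. The numerator is therefore the product
of 1 + X^i = (1 - X^(2i))/(1 - X^i) over i not divisible by 2k + 1. -/
theorem mk_brokenDiamondCount_mul (hk : 0 < k) :
    (mk fun n => (brokenDiamondCount k n : ℤ)) * eulerF 1 ^ 3 * eulerF (2 * (2 * k + 1))
      = eulerF 2 * eulerF (2 * k + 1) := by
  have hq : ∀ s u, (u + s) % (2 * k + 1) % 2 = 1 → ¬ (u + 1 + s) % (2 * k + 1) % 2 = 1 := by
    intro s u h
    rw [show u + 1 + s = u + s + 1 by omega, Nat.add_mod_eq_ite]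
    have : 1 % (2 * k + 1) = 1 := Nat.mod_eq_of_lt (by omega)
    rw [this]
    have := Nat.mod_lt (u + s) (show 0 < 2 * k + 1 by omega)
    split_ifs <;> omega
  have hle : ∀ n : ℕ, n ≤ n + 1 := fun n => n.le_succ
  have hle2 : ∀ n : ℕ, n ≤ 2 * (n + 1) := fun n => by omega
  have hmk : (mk fun n => (brokenDiamondCount k n : ℤ))
      = (mk fun n => ((layerPartitions (fun u => (u + 0) % (2 * k + 1) % 2 = 1) n).ncard : ℤ))
        * mk fun n => ((layerPartitions (fun u => (u + 1) % (2 * k + 1) % 2 = 1) n).ncard : ℤ) := by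
    ext n
    rw [coeff_mk, brokenDiamondCount_eq_sum hk, coeff_mul]
    push_cast
    simp only [coeff_mk]
  rw [hmk, mk_ncard_layerPartitions_eq_genFun (hq 0), mk_ncard_layerPartitions_eq_genFun (hq 1)]
  set g₀ : ℕ → ℕ → ℤ := fun i _ => if (i - 1 + 0) % (2 * k + 1) % 2 = 1 then 2 else 1 with hg₀
  set g₁ : ℕ → ℕ → ℤ := fun i _ => if (i - 1 + 1) % (2 * k + 1) % 2 = 1 then 2 else 1 with hg₁
  have m₀ := Nat.Partition.multipliable_genFun g₀
  have m₁ := Nat.Partition.multipliable_genFun g₁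
  have me := fun m => multipliable_one_sub_X_pow_pow (R := ℤ) hle
    fun n => if m ∣ n + 1 then 1 else 0
  have me2 := multipliable_one_sub_X_pow_pow (R := ℤ) hle2
    fun n => if 2 * k + 1 ∣ n + 1 then 1 else 0
  have me3 := multipliable_one_sub_X_pow_pow (R := ℤ) hle2 fun n => if 1 ∣ n + 1 then 1 else 0
  have hF2 := eulerF_two_mul_eq_tprod 1
  rw [mul_one] at hF2
  rw [hF2, eulerF_two_mul_eq_tprod, Nat.Partition.genFun_eq_tprod, Nat.Partition.genFun_eq_tprod,
    eulerF, eulerF, eulerProd, eulerProd, pow_succ, sq]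
  rw [← (me 1).tprod_mul (me 1), ← ((me 1).mul (me 1)).tprod_mul (me 1), ← m₀.tprod_mul m₁,
    ← (m₀.mul m₁).tprod_mul (((me 1).mul (me 1)).mul (me 1)),
    ← ((m₀.mul m₁).mul (((me 1).mul (me 1)).mul (me 1))).tprod_mul me2, ← me3.tprod_mul (me _)]
  -- All products now run over the same index, so the identity is checked factor by factor.
  refine tprod_congr fun n => ?_
  have e₀ := one_add_tsum_mul_one_sub (f := g₀) (i := n) (c := g₀ (n + 1) 1) fun j => rfl
  have e₁ := one_add_tsum_mul_one_sub (f := g₁) (i := n) (c := g₁ (n + 1) 1) fun j => rfl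
  have hcomb : ∀ s₀ s₁ x a b y z : ℤ⟦X⟧, s₀ * (1 - x) = a → s₁ * (1 - x) = b →
      a * b * (1 - x) * y = z → s₀ * s₁ * ((1 - x) * (1 - x) * (1 - x)) * y = z := by
    rintro s₀ s₁ x _ _ y z rfl rfl rfl
    ring
  simp only [one_dvd, if_true, pow_one]
  refine hcomb _ _ _ _ _ _ _ e₀ e₁ ?_
  have hc : n % (2 * k + 1) < 2 * k + 1 := Nat.mod_lt _ (by omega)
  have h1 : 1 % (2 * k + 1) = 1 := Nat.mod_eq_of_lt (by omega)
  have hn := Nat.add_mod_eq_ite (m := n) (n := 1) (k := 2 * k + 1)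
  rw [h1] at hn
  by_cases h : 2 * k + 1 ∣ n + 1
  · have h' := Nat.mod_eq_zero_of_dvd h
    have hn' : n % (2 * k + 1) = 2 * k := by split_ifs at hn <;> omega
    simp only [hg₀, hg₁, Nat.add_sub_cancel, add_zero, h', hn', h, Nat.mul_mod_right]
    norm_num
    ring
  · have h' : (n + 1) % (2 * k + 1) ≠ 0 := fun h0 => h (Nat.dvd_of_mod_eq_zero h0)
    by_cases hodd : n % (2 * k + 1) % 2 = 1
    · have hodd' : ¬ (n + 1) % (2 * k + 1) % 2 = 1 := by split_ifs at hn <;> omega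
      simp only [hg₀, hg₁, Nat.add_sub_cancel, add_zero, hodd, hodd', h, if_true, if_false]
      norm_num
      ring
    · have hodd' : (n + 1) % (2 * k + 1) % 2 = 1 := by split_ifs at hn <;> omega
      simp only [hg₀, hg₁, Nat.add_sub_cancel, add_zero, hodd, hodd', h, if_true, if_false]
      norm_num
      ring

/-- A factor in X^p shifts exponents by multiples of p, so divisibility along a residue class is
preserved. -/
theorem coeff_mul_expand_eq_zero_of_dvd {p r : ℕ} (hp : p ≠ 0) {d : ℤ} {f : ℤ⟦X⟧}
    (hr : r < p) (hf : ∀ n, d ∣ coeff (p * n + r) f) (g : ℤ⟦X⟧) (n : ℕ) :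
    d ∣ coeff (p * n + r) (f * expand p hp g) := by
  rw [coeff_mul]
  refine Finset.dvd_sum fun x hx => ?_
  rw [Finset.HasAntidiagonal.mem_antidiagonal] at hx
  by_cases h : p ∣ x.2
  · obtain ⟨j, hj⟩ := h
    have hjn : j ≤ n := by
      by_contra hlt
      have h1 : p * (n + 1) ≤ p * j := Nat.mul_le_mul_left _ (by omega)
      rw [mul_add] at h1
      omega
    obtain ⟨i, rfl⟩ := Nat.exists_eq_add_of_le hjn
    have : x.1 = p * i + r := by
      rw [mul_add] at hx
      omega
    rw [this]
    exact (hf i).mul_right _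
  · rw [coeff_expand, if_neg h, mul_zero]
    exact dvd_zero _

end DiamondChains

/-! ### The main theorem -/

theorem theorem1 (k n : ℕ) (hk : k ≡ 62 [MOD 125]) :
    brokenDiamondCount k (125 * n + 99) ≡ 0 [MOD 25] := by
  have hk0 : 0 < k := by
    rcases Nat.eq_zero_or_pos k with rfl | h
    · exact absurd hk (by decide)
    · exact h
  -- The class 62 is the solution of 2k + 1 = 0 modulo 125.
  obtain ⟨m, hm⟩ : ∃ m, 2 * k + 1 = 125 * m := by
    change k % 125 = 62 % 125 at hk
    exact ⟨(2 * k + 1) / 125, by omega⟩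
  have h1 := mk_brokenDiamondCount_mul hk0
  have h2 := brokenDiamondSeries_mul
  have h3 := congrArg (expand 125 (by norm_num)) (eulerF_mul_inv (2 * m))
  rw [map_mul, map_one, expand_eulerF] at h3
  rw [hm, show 2 * (125 * m) = 125 * (2 * m) by ring,
    ← expand_eulerF (show 125 ≠ 0 by norm_num) m] at h1
  have key : (mk fun n => (brokenDiamondCount k n : ℤ))
      = brokenDiamondSeries * expand 125 (by norm_num) (eulerF m * eulerFInv (2 * m)) := by
    rw [map_mul]
    refine mul_right_cancel₀ (pow_ne_zero 3 (eulerF_ne_zero 1)) ?_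
    refine mul_right_cancel₀ (eulerF_ne_zero (125 * (2 * m))) ?_
    generalize expand 125 (by norm_num) (eulerF m) = a at *
    generalize expand 125 (by norm_num) (eulerFInv (2 * m)) = b at *
    linear_combination h1 - a * b * eulerF (125 * (2 * m)) * h2 - eulerF 2 * a * h3
  have h4 := coeff_mul_expand_eq_zero_of_dvd (p := 125) (r := 99) (by norm_num) (by norm_num)
    dvd_coeff_brokenDiamondSeries (eulerF m * eulerFInv (2 * m)) n
  rw [← key, coeff_mk] at h4
  exact Nat.modEq_zero_iff_dvd.2 (by exact_mod_cast h4)
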